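/- \textbf{Setting.} Let $\mathcal H$ be a complex Hilbert space and $\rho$ a density operator on $\mathcal H$ (positive, trace $1$) with spectral decomposition $\rho=\sum_j s_j|\phi_j\rangle\langle\phi_j|$. Let $L^2_{sa}(\rho)$ be the set of (possibly unbounded) selfadjoint operators $X$ with $\phi_j\in\mathcal D(X)$ whenever $s_j\neq0$ and $\sum_j s_j\|X\phi_j\|^2<\infty$; let $\langle X|Y\rangle=\sum_j s_j\,\mathrm{Re}\,\langle X\phi_j,Y\phi_j\rangle$ be the SLD inner product, and let $\mathcal L^2_{sa}(\rho)$ be the quotient of $L^2_{sa}(\rho)$ that identifies $X,Y$ when $X\phi_j=Y\phi_j$ for all $j$ with $s_j\ne 0$. Put $J(X)=\rho\circ X=\frac12(\rho X+X\rho)$. Let $T$ (the tangent space $T_\rho P$ at $\rho$ of a finite-dimensional model $P$) be a finite-dimensional real vector space of traceless operators of the form $\rho\circ X$, $X\in\mathcal L^2_{sa}(\rho)$; let $T^*=\{X\in\mathcal L^2_{sa}(\rho): \rho\circ X\in T\}$, so that $J:T^*\to T$ is a bijection, with the pairing $\langle X,x\rangle=\langle X|J^{-1}x\rangle$ of $X\in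 T^*$ and $x\in T$, and equip $T$ with the inner product $\langle x,y\rangle_T=\langle J^{-1}x|J^{-1}y\rangle$. For each $X\in T^*$ fix a selfadjoint representative in $L^2_{sa}(\rho)$, with spectral measure $E_X$, and for $x\in T$ let $M(x,X)$ be the $T$-valued measurement that is the image of $E_X$ under $t\mapsto t x$. A probability measure $p$ on $T\times T^*$ defines the random measurement $M_p=\int M(x,X)\,p(dx,dX)$ (weak integral, whenever the integrand is $p$-measurable). A measurement $M$ with values in $T$ is locally unbiased if $\int_T x\,\mathrm{tr}(M(dx)\rho)=0$ and $\int_T x\,\mathrm{tr}(M(dx)\tau)=\tau$ for all $\tau\in T$, all integrals existing; its covariance is $V(M)=\int_T x\otimes x\,\mathrm{tr}(M(dx)\rho)\in T\otimes T$, regarded as the map $T^*\to T$, $X\mapsto\int_T\langle X,x\rangle\,x\,\mathrm{tr}(M(dx)\rho)$, and its deviation for a bilinear form $g$ on $T$ is $\mathrm{tr}\,(gV(M))=\int_T g(x,x)\,\mathrm{tr}(M(dx)\rho)\in[0,\infty]$. \textbf{Theorem.} Let $W:T\to T$ be linear, selfadjoint and positive semidefinite with respect to $\langle\cdot,\cdot\rangle_T$,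 with $\mathrm{tr}\,W=1$, and let $g(x,y)=\langle Wx,Wy\rangle_T$. Then the infimum of $\mathrm{tr}\,(gV(M_p))$ over all $p$ for which $M_p$ is defined and locally unbiased equals $1$. If moreover $W$ is positive definite, this infimum is a minimum. In that case $T$ has an orthonormal basis of eigenvectors of $W$, and for every orthonormal basis $(e_i)$ of $T$ with $We_i=W_ie_i$ all $W_i$ are positive and the random measurement $$M_W=\sum_i W_i\,M\bigl(W_i^{-1}e_i,\;J^{-1}e_i\bigr),$$ i.e. $M_p$ for $p=\sum_i W_i\,\delta_{(W_i^{-1}e_i,\,J^{-1}e_i)}$, is locally unbiased, has deviation exactly $1$, has finite second moments in the state $\rho$, and has covariance $V(M_W)=W^{-1}J$. -/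

import Mathlib

open scoped InnerProductSpace ENNReal
open MeasureTheory

universe u

namespace QuantumEstimation

variable {H : Type u} [NormedAddCommGroup H] [InnerProductSpace ℂ H] [CompleteSpace H]

/-- A density operator: a positive operator of trace `1`. -/
structure DensityOperator (H : Type u) [NormedAddCommGroup H] [InnerProductSpace ℂ H]
    [CompleteSpace H] where
  op : H →L[ℂ] H
  isPositive : op.IsPositive
  trace_eq_one : ∀ (ι : Type u) (b : HilbertBasis ι ℂ H),
    HasSum (fun i => ⟪b i, op (b i)⟫_ℂ) 1

theorem isCompactOperator_of_summable {ι : Type u} (b : HilbertBasis ι ℂ H) (A : H →L[ℂ] H)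
    (h : Summable fun i => ‖A (b i)‖ ^ 2) : IsCompactOperator A := by
  classical
  have hb := b.orthonormal
  let AF : Finset ι → (H →L[ℂ] H) := fun F =>
    ∑ i ∈ F, InnerProductSpace.rankOne ℂ (A (b i)) (b i)
  have hAF : ∀ F x, AF F x = ∑ i ∈ F, ⟪b i, x⟫_ℂ • A (b i) := by
    intro F x; simp [AF]
  have hcomp : ∀ F, IsCompactOperator (AF F) := by
    intro F
    change AF F ∈ compactOperator (RingHom.id ℂ) H H
    refine Submodule.sum_mem _ fun i _ => ?_
    change IsCompactOperator _
    have : IsCompactOperator (ContinuousLinearMap.toSpanSingleton ℂ (A (b i))) :=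
      isCompactOperator_of_locallyCompactSpace_rng _
    exact this.comp_clm (innerSL ℂ (b i))
  have hlim : Filter.Tendsto AF Filter.atTop (nhds A) := by
    rw [Metric.tendsto_atTop]
    intro ε hε
    obtain ⟨F, hF⟩ := summable_iff_vanishing_norm.1 h ((ε / 2) ^ 2) (by positivity)
    refine ⟨F, fun G hG => ?_⟩
    rw [dist_eq_norm]
    refine lt_of_le_of_lt (ContinuousLinearMap.opNorm_le_bound _ (by positivity : 0 ≤ ε / 2)
      fun x => ?_) (half_lt_self hε)
    have hs : HasSum (fun i => ⟪b i, x⟫_ℂ • A (b i)) (A x) := by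
      simpa [HilbertBasis.repr_apply_apply] using (b.hasSum_repr x).mapL A
    have ht : Filter.Tendsto (fun K : Finset ι => ‖AF G x - AF K x‖) Filter.atTop
        (nhds ‖AF G x - A x‖) := by
      refine (tendsto_const_nhds.sub ?_).norm
      simp only [hAF]; exact hs
    refine le_of_tendsto ht ?_
    filter_upwards [Filter.eventually_ge_atTop G] with K hK
    have e : AF G x - AF K x = - ∑ i ∈ K \ G, ⟪b i, x⟫_ℂ • A (b i) := by
      rw [hAF, hAF, ← Finset.sum_sdiff hK]; abel
    rw [e, norm_neg]
    have h1 : ‖∑ i ∈ K \ G, ⟪b i, x⟫_ℂ • A (b i)‖ ≤ ∑ i ∈ K \ G, ‖⟪b i, x⟫_ℂ‖ * ‖A (b i)‖ := by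
      refine (norm_sum_le _ _).trans (le_of_eq ?_)
      simp [norm_smul]
    have h2 := Finset.sum_mul_sq_le_sq_mul_sq (K \ G) (fun i => ‖⟪b i, x⟫_ℂ‖) (fun i => ‖A (b i)‖)
    have h3 := hb.sum_inner_products_le (x := x) (s := K \ G)
    have h4 : ∑ i ∈ K \ G, ‖A (b i)‖ ^ 2 ≤ (ε / 2) ^ 2 := by
      refine (le_abs_self _).trans (hF _ ?_).le
      exact Finset.disjoint_of_subset_right hG Finset.sdiff_disjoint
    refine h1.trans (pow_le_pow_iff_left₀ (by positivity) (by positivity) two_ne_zero |>.1 ?_)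
    calc _ ≤ _ := h2
      _ ≤ ‖x‖ ^ 2 * (ε / 2) ^ 2 := by gcongr
      _ = _ := by ring
  exact isCompactOperator_of_tendsto hlim (Filter.Eventually.of_forall hcomp)

theorem DensityOperator.isCompactOperator (ρ : DensityOperator H) : IsCompactOperator ρ.op := by
  obtain ⟨w, b, -⟩ := exists_hilbertBasis ℂ H
  have h0 : (0 : H →L[ℂ] H) ≤ ρ.op := (ContinuousLinearMap.nonneg_iff_isPositive _).2 ρ.isPositive
  let R := CFC.sqrt ρ.op
  have hR : R * R = ρ.op := CFC.sqrt_mul_sqrt_self ρ.op h0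
  have hR' : IsSelfAdjoint R := (CFC.sqrt_nonneg ρ.op).isSelfAdjoint
  have hs : Summable fun i => ‖R (b i)‖ ^ 2 := by
    have := (Complex.hasSum_re (ρ.trace_eq_one w b)).summable
    refine this.congr fun i => ?_
    rw [← hR, mul_apply_eq_comp, ← ContinuousLinearMap.adjoint_inner_left,
      ← ContinuousLinearMap.star_eq_adjoint, hR'.star_eq, inner_self_eq_norm_sq_to_K]
    norm_cast
  have := isCompactOperator_of_summable b R hs
  rw [← hR]
  exact this.comp_clm R

theorem DensityOperator.exists_eigenbasis (ρ : DensityOperator H) :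
    ∃ (ι : Type u) (b : HilbertBasis ι ℂ H) (s : ι → ℝ), ∀ i, ρ.op (b i) = (s i : ℂ) • b i := by
  have hsymm := ρ.isPositive.isSymmetric
  have hbot := ContinuousLinearMap.orthogonalComplement_iSup_eigenspaces_eq_bot
    ρ.isCompactOperator hsymm
  have hfam := hsymm.orthogonalFamily_eigenspaces
  have hcl : ∀ μ : ℂ, CompleteSpace (Module.End.eigenspace (ρ.op : Module.End ℂ H) μ) := by
    intro μ
    have : IsClosed ((Module.End.eigenspace (ρ.op : Module.End ℂ H) μ : Submodule ℂ H) : Set H) := by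
      have e : ((Module.End.eigenspace (ρ.op : Module.End ℂ H) μ : Submodule ℂ H) : Set H)
          = {x | ρ.op x = μ • x} := by
        ext x; simp
      rw [e]
      exact isClosed_eq ρ.op.continuous (continuous_const_smul μ)
    exact this.completeSpace_coe
  choose w b hb using fun μ : ℂ =>
    exists_hilbertBasis ℂ (Module.End.eigenspace (ρ.op : Module.End ℂ H) μ)
  have ho := hfam.orthonormal_sigma_orthonormal (v_family := fun μ i => b μ i)
    fun μ => (b μ).orthonormal
  let v : (Σ μ : ℂ, w μ) → H := fun a => (b a.1 a.2 : H)
  have hv : Orthonormal ℂ v := ho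
  have hperp : (Submodule.span ℂ (Set.range v))ᗮ = ⊥ := by
    rw [eq_bot_iff, ← hbot]
    intro x hx
    rw [Submodule.mem_orthogonal] at hx ⊢
    have key : ∀ μ, ∀ y : Module.End.eigenspace (ρ.op : Module.End ℂ H) μ, ⟪(y : H), x⟫_ℂ = 0 := by
      intro μ y
      have hs := (b μ).hasSum_repr y
      have hs' : HasSum (fun i => (b μ).repr y i • ((b μ i : _) : H)) (y : H) := by
        simpa using hs.mapL (Submodule.subtypeL _)
      have : HasSum (fun i => ⟪(b μ).repr y i • ((b μ i : _) : H), x⟫_ℂ) ⟪(y : H), x⟫_ℂ :=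
        hs'.map (AddMonoidHom.mk' (fun z => ⟪z, x⟫_ℂ) fun a c => inner_add_left a c x)
          (by exact Continuous.inner continuous_id continuous_const)
      refine this.unique ?_
      have hz : ∀ i, ⟪((b μ i : _) : H), x⟫_ℂ = 0 := fun i =>
        hx _ (Submodule.subset_span ⟨⟨μ, i⟩, rfl⟩)
      simp only [inner_smul_left, hz, mul_zero]
      exact hasSum_zero
    intro y hy
    refine Submodule.iSup_induction _ (motive := fun y => ⟪y, x⟫_ℂ = 0) hy
      (fun μ y hy => key μ ⟨y, hy⟩) (by simp) fun a c ha hc => by rw [inner_add_left, ha, hc, add_zero]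
  refine ⟨(Σ μ : ℂ, w μ), HilbertBasis.mkOfOrthogonalEqBot hv hperp, fun a => a.1.re, ?_⟩
  rintro ⟨μ, i⟩
  rw [HilbertBasis.coe_mkOfOrthogonalEqBot]
  have hmem : ρ.op (b μ i : H) = μ • (b μ i : H) := Module.End.mem_eigenspace_iff.1 (b μ i).2
  have hne : ((b μ i : _) : H) ≠ 0 := by
    have := (b μ).orthonormal.ne_zero i
    simpa using this
  have hev : Module.End.HasEigenvalue (ρ.op : Module.End ℂ H) μ :=
    Module.End.hasEigenvalue_of_hasEigenvector (x := (b μ i : H)) ⟨(b μ i).2, hne⟩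
  have := hsymm.conj_eigenvalue_eq_self hev
  change ρ.op (b μ i : H) = _
  rw [hmem, Complex.conj_eq_iff_re.1 this]


namespace DensityOperator

variable (ρ : DensityOperator H)

/-- Index type of the spectral decomposition `ρ = ∑ j, s j |φ j⟩⟨φ j|`. -/
def Index : Type u := ρ.exists_eigenbasis.choose

/-- The eigenvectors `φ j` in the spectral decomposition of `ρ` (a Hilbert basis of `H`). -/
noncomputable def eigenbasis : HilbertBasis ρ.Index ℂ H := ρ.exists_eigenbasis.choose_spec.choose

/-- The eigenvalues `s j` in the spectral decomposition of `ρ`. -/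
noncomputable def eigenvalue : ρ.Index → ℝ := ρ.exists_eigenbasis.choose_spec.choose_spec.choose

theorem op_eigenbasis (j : ρ.Index) :
    ρ.op (ρ.eigenbasis j) = (ρ.eigenvalue j : ℂ) • ρ.eigenbasis j :=
  ρ.exists_eigenbasis.choose_spec.choose_spec.choose_spec j

theorem inner_op_eigenbasis (j : ρ.Index) :
    ⟪ρ.eigenbasis j, ρ.op (ρ.eigenbasis j)⟫_ℂ = ρ.eigenvalue j := by
  rw [op_eigenbasis, inner_smul_right, inner_self_eq_norm_sq_to_K,
    ρ.eigenbasis.orthonormal.norm_eq_one]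
  simp

theorem eigenvalue_nonneg (j : ρ.Index) : 0 ≤ ρ.eigenvalue j := by
  have := ρ.isPositive.re_inner_nonneg_right (ρ.eigenbasis j)
  rw [inner_op_eigenbasis] at this
  simpa using this

theorem hasSum_eigenvalue : HasSum ρ.eigenvalue 1 := by
  have := Complex.hasSum_re (ρ.trace_eq_one _ ρ.eigenbasis)
  simpa [inner_op_eigenbasis] using this

/-- The trace of an operator, computed in the orthonormal eigenbasis of `ρ`. -/
noncomputable def trace (A : H →L[ℂ] H) : ℂ := ∑' j, ⟪ρ.eigenbasis j, A (ρ.eigenbasis j)⟫_ℂ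

end DensityOperator

/-- A generalized measurement (positive operator valued measure) on `H` with outcomes in `Ω`. -/
structure POVM (Ω : Type*) [MeasurableSpace Ω] (H : Type u) [NormedAddCommGroup H]
    [InnerProductSpace ℂ H] [CompleteSpace H] where
  toFun : Set Ω → H →L[ℂ] H
  isPositive : ∀ B, MeasurableSet B → (toFun B).IsPositive
  univ : toFun Set.univ = 1
  hasSum_iUnion : ∀ f : ℕ → Set Ω, (∀ n, MeasurableSet (f n)) →
    Pairwise (Function.onFun Disjoint f) →
    ∀ ψ χ : H, HasSum (fun n => ⟪ψ, toFun (f n) χ⟫_ℂ) ⟪ψ, toFun (⋃ n, f n) χ⟫_ℂ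

namespace POVM

variable {Ω : Type*} [MeasurableSpace Ω]

instance : CoeFun (POVM Ω H) (fun _ => Set Ω → H →L[ℂ] H) := ⟨POVM.toFun⟩

theorem empty (M : POVM Ω H) : M ∅ = 0 := by
  ext χ
  refine ext_inner_left ℂ fun ψ => ?_
  have h := M.hasSum_iUnion (fun _ => ∅) (fun _ => MeasurableSet.empty)
    (fun _ _ _ => by simp [Function.onFun]) ψ χ
  simpa using tendsto_nhds_unique tendsto_const_nhds h.summable.tendsto_atTop_zero

theorem re_inner_nonneg (M : POVM Ω H) {B : Set Ω} (hB : MeasurableSet B) (ψ : H) :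
    0 ≤ (⟪ψ, M B ψ⟫_ℂ).re := (M.isPositive B hB).re_inner_nonneg_right ψ

theorem add_compl (M : POVM Ω H) {B : Set Ω} (hB : MeasurableSet B) : M B + M Bᶜ = 1 := by
  classical
  ext χ
  refine ext_inner_left ℂ fun ψ => ?_
  let f : ℕ → Set Ω := fun n => if n = 0 then B else if n = 1 then Bᶜ else ∅
  have hU : (⋃ n, f n) = Set.univ := by
    refine Set.eq_univ_of_forall fun x => ?_
    by_cases hx : x ∈ B
    · exact Set.mem_iUnion.2 ⟨0, by simpa [f] using hx⟩
    · exact Set.mem_iUnion.2 ⟨1, by simpa [f] using hx⟩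
  have h := M.hasSum_iUnion f
    (fun n => by
      by_cases h0 : n = 0
      · simpa [f, h0] using hB
      · by_cases h1 : n = 1
        · simpa [f, h1] using hB
        · simp [f, h0, h1])
    (fun m n hmn => by
      simp only [Function.onFun, f]
      split_ifs <;> first | omega | exact disjoint_compl_right | exact disjoint_compl_left | simp)
    ψ χ
  rw [hU, M.univ] at h
  have h2 : HasSum (fun n => ⟪ψ, M (f n) χ⟫_ℂ) (∑ n ∈ Finset.range 2, ⟪ψ, M (f n) χ⟫_ℂ) := by
    refine hasSum_sum_of_ne_finset_zero fun n hn => ?_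
    have : 1 < n := by simpa using hn
    have e : f n = ∅ := by simp only [f]; rw [if_neg (by omega), if_neg (by omega)]
    rw [e, M.empty]; simp
  have := h2.unique h
  simpa [Finset.sum_range_succ, f, inner_add_right] using this

theorem norm_le_one (M : POVM Ω H) {B : Set Ω} (hB : MeasurableSet B) : ‖M B‖ ≤ 1 := by
  rw [CStarAlgebra.norm_le_one_iff_of_nonneg _
    ((ContinuousLinearMap.nonneg_iff_isPositive _).2 (M.isPositive B hB)), ← M.add_compl hB]
  exact le_add_of_nonneg_right
    ((ContinuousLinearMap.nonneg_iff_isPositive _).2 (M.isPositive _ hB.compl))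

theorem norm_inner_le (M : POVM Ω H) {B : Set Ω} (hB : MeasurableSet B) (ψ χ : H) :
    ‖⟪ψ, M B χ⟫_ℂ‖ ≤ ‖ψ‖ * ‖χ‖ := by
  refine (norm_inner_le_norm _ _).trans ?_
  gcongr
  simpa using (M B).le_of_opNorm_le (M.norm_le_one hB) χ

/-- The positive measure `B ↦ ⟨ψ, M(B) ψ⟩`. -/
noncomputable def diag (M : POVM Ω H) (ψ : H) : Measure Ω :=
  Measure.ofMeasurable (fun B _ => ENNReal.ofReal (⟪ψ, M B ψ⟫_ℂ).re)
    (by simp [M.empty])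
    (by
      intro f hf hd
      have h := Complex.hasSum_re (M.hasSum_iUnion f hf hd ψ ψ)
      rw [← h.tsum_eq]
      exact ENNReal.ofReal_tsum_of_nonneg (fun n => M.re_inner_nonneg (hf n) ψ) h.summable)

theorem diag_apply (M : POVM Ω H) (ψ : H) {B : Set Ω} (hB : MeasurableSet B) :
    M.diag ψ B = ENNReal.ofReal (⟪ψ, M B ψ⟫_ℂ).re := Measure.ofMeasurable_apply B hB

theorem ofReal_trace (M : POVM Ω H) (ρ : DensityOperator H) {B : Set Ω} (hB : MeasurableSet B) :
    ENNReal.ofReal (ρ.trace (M B * ρ.op)).re =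
      ∑' j, ENNReal.ofReal (ρ.eigenvalue j) * M.diag (ρ.eigenbasis j) B := by
  have e : ∀ j, ⟪ρ.eigenbasis j, (M B * ρ.op) (ρ.eigenbasis j)⟫_ℂ
      = ρ.eigenvalue j * ⟪ρ.eigenbasis j, M B (ρ.eigenbasis j)⟫_ℂ := by
    intro j
    rw [mul_apply_eq_comp, ρ.op_eigenbasis, map_smul, inner_smul_right]
  have hsum : Summable fun j => ⟪ρ.eigenbasis j, (M B * ρ.op) (ρ.eigenbasis j)⟫_ℂ := by
    refine Summable.of_norm_bounded ρ.hasSum_eigenvalue.summable fun j => ?_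
    rw [e, norm_mul]
    have h1 := M.norm_inner_le hB (ρ.eigenbasis j) (ρ.eigenbasis j)
    rw [ρ.eigenbasis.orthonormal.norm_eq_one] at h1
    have h2 : ‖(ρ.eigenvalue j : ℂ)‖ = ρ.eigenvalue j := by
      simp [abs_of_nonneg (ρ.eigenvalue_nonneg j)]
    rw [h2]
    exact mul_le_of_le_one_right (ρ.eigenvalue_nonneg j) (by simpa using h1)
  have hre := Complex.hasSum_re hsum.hasSum
  have e' : ∀ j, (⟪ρ.eigenbasis j, (M B * ρ.op) (ρ.eigenbasis j)⟫_ℂ).re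
      = ρ.eigenvalue j * (⟪ρ.eigenbasis j, M B (ρ.eigenbasis j)⟫_ℂ).re := by
    intro j; rw [e, Complex.re_ofReal_mul]
  simp only [e'] at hre
  rw [DensityOperator.trace, ← hre.tsum_eq, ENNReal.ofReal_tsum_of_nonneg (fun j =>
    mul_nonneg (ρ.eigenvalue_nonneg j) (M.re_inner_nonneg hB _)) hre.summable]
  refine tsum_congr fun j => ?_
  rw [ENNReal.ofReal_mul (ρ.eigenvalue_nonneg j), M.diag_apply _ hB]

/-- The distribution `B ↦ tr (M(B) ρ)` of the outcome of `M` in the state `ρ`. -/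
noncomputable def law (M : POVM Ω H) (ρ : DensityOperator H) : Measure Ω :=
  Measure.ofMeasurable (fun B _ => ENNReal.ofReal (ρ.trace (M B * ρ.op)).re)
    (by simp [M.empty, DensityOperator.trace])
    (by
      intro f hf hd
      rw [M.ofReal_trace ρ (MeasurableSet.iUnion hf), tsum_congr fun n => M.ofReal_trace ρ (hf n),
        ENNReal.tsum_comm]
      refine tsum_congr fun j => ?_
      rw [measure_iUnion hd hf, ENNReal.tsum_mul_left])

/-- The image measurement `B ↦ M (f⁻¹ B)`. -/
def map {Ω' : Type*} [MeasurableSpace Ω'] (M : POVM Ω H) (f : Ω → Ω') (hf : Measurable f) :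
    POVM Ω' H where
  toFun B := M (f ⁻¹' B)
  isPositive B hB := M.isPositive _ (hf hB)
  univ := by rw [Set.preimage_univ, M.univ]
  hasSum_iUnion F hF hd ψ χ := by
    rw [Set.preimage_iUnion]
    exact M.hasSum_iUnion _ (fun n => hf (hF n)) (fun m n hmn => (hd hmn).preimage f) ψ χ

variable {S : Type*} [MeasurableSpace S]

/-- The mixture `∫ κ s p(ds)` makes sense: all functions `s ↦ ⟨ψ, κ s (B) χ⟩` are `p`-measurable. -/
def IsMixable (κ : S → POVM Ω H) (p : Measure S) : Prop :=
  ∀ B, MeasurableSet B → ∀ ψ χ : H, AEStronglyMeasurable (fun s => ⟪ψ, κ s B χ⟫_ℂ) p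

theorem IsMixable.integrable {κ : S → POVM Ω H} {p : Measure S} [IsFiniteMeasure p]
    (h : IsMixable κ p) {B : Set Ω} (hB : MeasurableSet B) (ψ χ : H) :
    Integrable (fun s => ⟪ψ, κ s B χ⟫_ℂ) p :=
  Integrable.of_bound (h B hB ψ χ) (‖ψ‖ * ‖χ‖)
    (Filter.Eventually.of_forall fun s => (κ s).norm_inner_le hB ψ χ)

/-- The form `(ψ, χ) ↦ ∫ ⟨ψ, κ s (B) χ⟩ p(ds)`. -/
noncomputable def mixForm (κ : S → POVM Ω H) (p : Measure S) [IsProbabilityMeasure p]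
    (h : IsMixable κ p) (B : Set Ω) (hB : MeasurableSet B) : H →L⋆[ℂ] H →L[ℂ] ℂ :=
  LinearMap.mkContinuous₂
    (LinearMap.mk₂'ₛₗ (starRingEnd ℂ) (RingHom.id ℂ) (fun ψ χ => ∫ s, ⟪ψ, κ s B χ⟫_ℂ ∂p)
      (fun ψ₁ ψ₂ χ => by
        simp only [inner_add_left]
        exact integral_add (h.integrable hB ψ₁ χ) (h.integrable hB ψ₂ χ))
      (fun c ψ χ => by
        simp only [inner_smul_left, smul_eq_mul]
        exact integral_const_mul _ _)
      (fun ψ χ₁ χ₂ => by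
        simp only [map_add, inner_add_right]
        exact integral_add (h.integrable hB ψ χ₁) (h.integrable hB ψ χ₂))
      (fun c ψ χ => by
        simp only [map_smul, inner_smul_right, smul_eq_mul, RingHom.id_apply]
        exact integral_const_mul _ _)) 1
    (fun ψ χ => by
      rw [LinearMap.mk₂'ₛₗ_apply]
      refine (norm_integral_le_of_norm_le_const (C := ‖ψ‖ * ‖χ‖)
        (Filter.Eventually.of_forall fun s => (κ s).norm_inner_le hB ψ χ)).trans ?_
      simp)


theorem mixForm_apply (κ : S → POVM Ω H) (p : Measure S) [IsProbabilityMeasure p]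
    (h : IsMixable κ p) (B : Set Ω) (hB : MeasurableSet B) (ψ χ : H) :
    mixForm κ p h B hB ψ χ = ∫ s, ⟪ψ, κ s B χ⟫_ℂ ∂p := rfl

open Classical in
/-- The effect `∫ κ s (B) p(ds)`, as a weak integral. -/
noncomputable def mixFun (κ : S → POVM Ω H) (p : Measure S) [IsProbabilityMeasure p]
    (h : IsMixable κ p) (B : Set Ω) : H →L[ℂ] H :=
  if hB : MeasurableSet B then
    (InnerProductSpace.continuousLinearMapOfBilin (mixForm κ p h B hB)).adjoint
  else 0

theorem inner_mixFun (κ : S → POVM Ω H) (p : Measure S) [IsProbabilityMeasure p]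
    (h : IsMixable κ p) {B : Set Ω} (hB : MeasurableSet B) (ψ χ : H) :
    ⟪ψ, mixFun κ p h B χ⟫_ℂ = ∫ s, ⟪ψ, κ s B χ⟫_ℂ ∂p := by
  rw [mixFun, dif_pos hB, ContinuousLinearMap.adjoint_inner_right,
    InnerProductSpace.continuousLinearMapOfBilin_apply, mixForm_apply]

theorem norm_inner_le_half (M : POVM Ω H) {B : Set Ω} (hB : MeasurableSet B) (ψ χ : H) :
    ‖⟪ψ, M B χ⟫_ℂ‖ ≤ ((⟪ψ, M B ψ⟫_ℂ).re + (⟪χ, M B χ⟫_ℂ).re) / 2 := by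
  have h0 : (0 : H →L[ℂ] H) ≤ M B :=
    (ContinuousLinearMap.nonneg_iff_isPositive _).2 (M.isPositive B hB)
  let R := CFC.sqrt (M B)
  have hR : R * R = M B := CFC.sqrt_mul_sqrt_self (M B) h0
  have hR' : IsSelfAdjoint R := (CFC.sqrt_nonneg (M B)).isSelfAdjoint
  have hi : ∀ a c : H, ⟪a, M B c⟫_ℂ = ⟪R a, R c⟫_ℂ := by
    intro a c
    rw [← hR, mul_apply_eq_comp, ← ContinuousLinearMap.adjoint_inner_left,
      ← ContinuousLinearMap.star_eq_adjoint, hR'.star_eq]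
  have hn : ∀ a : H, (⟪R a, R a⟫_ℂ).re = ‖R a‖ ^ 2 := by
    intro a; rw [inner_self_eq_norm_sq_to_K]; norm_cast
  rw [hi, hi, hi, hn, hn]
  have := norm_inner_le_norm (𝕜 := ℂ) (R ψ) (R χ)
  nlinarith [sq_nonneg (‖R ψ‖ - ‖R χ‖)]

/-- The mixture `B ↦ ∫ κ s (B) p(ds)` of the measurements `κ s`. -/
noncomputable def mix (κ : S → POVM Ω H) (p : Measure S) [IsProbabilityMeasure p]
    (h : IsMixable κ p) : POVM Ω H where
  toFun := mixFun κ p h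
  isPositive B hB := by
    rw [ContinuousLinearMap.isPositive_iff_complex]
    intro ψ
    have e : ∀ s, ⟪ψ, κ s B ψ⟫_ℂ = ((⟪ψ, κ s B ψ⟫_ℂ).re : ℂ) := fun s => by
      have := ((κ s).isPositive B hB).isSymmetric.coe_re_inner_self_apply ψ
      exact this.symm
    have h1 : ⟪ψ, mixFun κ p h B ψ⟫_ℂ = ((∫ s, (⟪ψ, κ s B ψ⟫_ℂ).re ∂p : ℝ) : ℂ) := by
      rw [inner_mixFun κ p h hB, ← integral_complex_ofReal]
      exact integral_congr_ae (Filter.Eventually.of_forall e)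
    have h2 : ⟪mixFun κ p h B ψ, ψ⟫_ℂ = ((∫ s, (⟪ψ, κ s B ψ⟫_ℂ).re ∂p : ℝ) : ℂ) := by
      rw [← inner_conj_symm, h1, Complex.conj_ofReal]
    rw [h2]
    exact ⟨by simp, by
      simpa using integral_nonneg fun s => (κ s).re_inner_nonneg hB ψ⟩
  univ := by
    ext χ
    refine ext_inner_left ℂ fun ψ => ?_
    rw [inner_mixFun κ p h MeasurableSet.univ]
    simp [(κ _).univ]
  hasSum_iUnion f hf hd ψ χ := by
    rw [inner_mixFun κ p h (MeasurableSet.iUnion hf)]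
    simp only [inner_mixFun κ p h (hf _)]
    have hb : ∀ s, HasSum
        (fun n => ((⟪ψ, κ s (f n) ψ⟫_ℂ).re + (⟪χ, κ s (f n) χ⟫_ℂ).re) / 2)
        (((⟪ψ, κ s (⋃ n, f n) ψ⟫_ℂ).re + (⟪χ, κ s (⋃ n, f n) χ⟫_ℂ).re) / 2) := fun s =>
      ((Complex.hasSum_re ((κ s).hasSum_iUnion f hf hd ψ ψ)).add
        (Complex.hasSum_re ((κ s).hasSum_iUnion f hf hd χ χ))).div_const 2
    refine hasSum_integral_of_dominated_convergence
      (fun n s => ((⟪ψ, κ s (f n) ψ⟫_ℂ).re + (⟪χ, κ s (f n) χ⟫_ℂ).re) / 2)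
      (fun n => h _ (hf n) ψ χ)
      (fun n => Filter.Eventually.of_forall fun s => (κ s).norm_inner_le_half (hf n) ψ χ)
      (Filter.Eventually.of_forall fun s => (hb s).summable) ?_
      (Filter.Eventually.of_forall fun s => (κ s).hasSum_iUnion f hf hd ψ χ)
    simp only [fun s => (hb s).tsum_eq]
    exact ((h.integrable (MeasurableSet.iUnion hf) ψ ψ).re.add
      (h.integrable (MeasurableSet.iUnion hf) χ χ).re).div_const 2

end POVM

/-- The value `X v`, for `v` in the domain of `X` (and `0` outside the domain). -/
noncomputable def apply₀ (X : H →ₗ.[ℂ] H) (v : H) : H :=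
  open Classical in if h : v ∈ X.domain then X ⟨v, h⟩ else 0

/-- `X` is a (possibly unbounded) selfadjoint operator with all `φ j`, `s j ≠ 0`, in its domain and
`∑ j, s j ‖X (φ j)‖² < ∞`. -/
structure MemL2 (ρ : DensityOperator H) (X : H →ₗ.[ℂ] H) : Prop where
  isSelfAdjoint : IsSelfAdjoint X
  mem_domain : ∀ j, ρ.eigenvalue j ≠ 0 → ρ.eigenbasis j ∈ X.domain
  summable : Summable fun j => ρ.eigenvalue j * ‖apply₀ X (ρ.eigenbasis j)‖ ^ 2

/-- The space `L²_sa(ρ)`. -/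
def L2sa (ρ : DensityOperator H) : Type u := {X : H →ₗ.[ℂ] H // MemL2 ρ X}

/-- Two elements of `L²_sa(ρ)` are identified when `∑ j, s j ‖X (φ j) - Y (φ j)‖² = 0`, that is,
when `X (φ j) = Y (φ j)` for all `j` with `s j ≠ 0`. -/
instance l2saSetoid (ρ : DensityOperator H) : Setoid (L2sa ρ) where
  r X Y := ∀ j, ρ.eigenvalue j ≠ 0 →
    apply₀ X.1 (ρ.eigenbasis j) = apply₀ Y.1 (ρ.eigenbasis j)
  iseqv :=
    ⟨fun _ _ _ => rfl, fun h j hj => (h j hj).symm, fun h k j hj => (h j hj).trans (k j hj)⟩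

/-- The quotient space `𝓛²_sa(ρ)`. -/
def QuotL2sa (ρ : DensityOperator H) : Type u := Quotient (l2saSetoid ρ)

/-- The SLD inner product `⟨X|Y⟩ = ∑ j, s j Re ⟨X φ j, Y φ j⟩`. -/
noncomputable def sldInner {ρ : DensityOperator H} : QuotL2sa ρ → QuotL2sa ρ → ℝ :=
  Quotient.lift₂
    (fun X Y => ∑' j, ρ.eigenvalue j *
      (⟪apply₀ X.1 (ρ.eigenbasis j), apply₀ Y.1 (ρ.eigenbasis j)⟫_ℂ).re)
    (fun X Y X' Y' hX hY => tsum_congr fun j => by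
      by_cases hj : ρ.eigenvalue j = 0
      · simp [hj]
      · rw [hX j hj, hY j hj])

/-- `ρ ∘ X = (ρ X + X ρ) / 2`, where `X ρ = ∑ j, s j |X φ j⟩⟨φ j|` and
`ρ X = ∑ j, s j |φ j⟩⟨X φ j|`. -/
noncomputable def jordan {ρ : DensityOperator H} : QuotL2sa ρ → (H →L[ℂ] H) :=
  Quotient.lift
    (fun X => (1 / 2 : ℂ) • ∑' j, (ρ.eigenvalue j : ℂ) •
      (InnerProductSpace.rankOne ℂ (ρ.eigenbasis j) (apply₀ X.1 (ρ.eigenbasis j)) +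
        InnerProductSpace.rankOne ℂ (apply₀ X.1 (ρ.eigenbasis j)) (ρ.eigenbasis j)))
    (fun X X' hX => congrArg _ <| tsum_congr fun j => by
      by_cases hj : ρ.eigenvalue j = 0
      · simp [hj]
      · rw [hX j hj])

/-- `T` can be the tangent space at `ρ` of a model: its elements are traceless and of the form
`ρ ∘ X` with `X ∈ 𝓛²_sa(ρ)`. -/
structure IsTangentSpace (ρ : DensityOperator H) (T : Submodule ℝ (H →L[ℂ] H)) : Prop where
  exists_jordan_eq : ∀ τ ∈ T, ∃ X : QuotL2sa ρ, jordan X = τ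
  trace_eq_zero : ∀ τ ∈ T, ρ.trace τ = 0

/-- The cotangent space, identified with `{X ∈ 𝓛²_sa(ρ) | ρ ∘ X ∈ T}`. -/
def Cotangent (ρ : DensityOperator H) (T : Submodule ℝ (H →L[ℂ] H)) : Type u :=
  {X : QuotL2sa ρ // jordan X ∈ T}

namespace Cotangent

variable {ρ : DensityOperator H} {T : Submodule ℝ (H →L[ℂ] H)}

/-- The map `J : T* → T`, `X ↦ ρ ∘ X`. -/
noncomputable def J (c : Cotangent ρ T) : T := ⟨jordan c.1, c.2⟩

/-- The inverse `J⁻¹ : T → T*`. -/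
noncomputable def Jinv (hT : IsTangentSpace ρ T) (x : T) : Cotangent ρ T :=
  ⟨(hT.exists_jordan_eq x x.2).choose, by
    rw [(hT.exists_jordan_eq x x.2).choose_spec]; exact x.2⟩

/-- The Borel structure of `T*`, transported from `T` by `J`. -/
noncomputable instance : MeasurableSpace (Cotangent ρ T) := MeasurableSpace.comap J inferInstance

/-- The pairing `⟨X, x⟩ = tr (x X)` of `X ∈ T*` with `x ∈ T`. -/
noncomputable def pairing (hT : IsTangentSpace ρ T) (c : Cotangent ρ T) (x : T) : ℝ :=
  sldInner c.1 (Jinv hT x).1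

/-- The inner product `J⁻¹` on `T` dual to the SLD inner product. -/
noncomputable def starInner (hT : IsTangentSpace ρ T) (x y : T) : ℝ :=
  pairing hT (Jinv hT x) y

end Cotangent

/-- `E` is the spectral decomposition of the selfadjoint operator `X`: a projection valued measure
on `ℝ` with `X = ∫ t E(dt)`. -/
structure IsSpectralMeasure (X : H →ₗ.[ℂ] H) (E : POVM ℝ H) : Prop where
  isIdempotentElem : ∀ B, MeasurableSet B → IsIdempotentElem (E B)
  mem_domain_iff : ∀ ψ, ψ ∈ X.domain ↔ ∫⁻ t, ENNReal.ofReal (t ^ 2) ∂E.diag ψ < ∞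
  inner_apply : ∀ ψ : X.domain, ⟪(ψ : H), X ψ⟫_ℂ = ((∫ t, t ∂E.diag ψ : ℝ) : ℂ)

section Estimation

variable {ρ : DensityOperator H} {T : Submodule ℝ (H →L[ℂ] H)}

/-- `E(M)(τ) = ∫ x tr (M(dx) τ)` exists and equals `v`. -/
def HasMean (ρ : DensityOperator H) (M : POVM T H) (τ : H →L[ℂ] H) (v : T) : Prop :=
  ∃ μ : SignedMeasure T, (∀ B, MeasurableSet B → μ B = (ρ.trace (M B * τ)).re) ∧
    μ.Integrable (fun x => x) ∧ ∫ᵛ x, x ∂<•μ = v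

/-- `M` is locally unbiased at `ρ`. -/
def IsLocallyUnbiased (ρ : DensityOperator H) (M : POVM T H) : Prop :=
  HasMean ρ M ρ.op 0 ∧ ∀ τ : T, HasMean ρ M τ τ

/-- The measurement `M^T(x, X)`: the image of the spectral decomposition of the chosen
representative of `X` under `t ↦ t x`. -/
noncomputable def simpleMeasurement (E : Cotangent ρ T → POVM ℝ H) (a : T × Cotangent ρ T) :
    POVM T H :=
  (E a.2).map (fun t => t • a.1) (by fun_prop)

/-- The deviation `tr (g V(M)) = ∫ g(x, x) tr (M(dx) ρ)`. -/
noncomputable def deviation (ρ : DensityOperator H) (g : LinearMap.BilinForm ℝ T)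
    (M : POVM T H) : ℝ≥0∞ :=
  ∫⁻ x, ENNReal.ofReal (g x x) ∂M.law ρ

/-- The covariance `V(M) = ∫ x ⊗ x tr (M(dx) ρ)`, as a map `T* → T`. -/
noncomputable def covariance (hT : IsTangentSpace ρ T) (M : POVM T H) (c : Cotangent ρ T) : T :=
  ∫ x, Cotangent.pairing hT c x • x ∂M.law ρ

/-- The deviations of the locally unbiased random measurements `∫ M^T(x, X) p(dx, dX)`, where `p`
ranges over the probability measures on `T × T*` for which this integral makes sense. -/
def randomDeviations (E : Cotangent ρ T → POVM ℝ H) (g : LinearMap.BilinForm ℝ T) : Set ℝ≥0∞ :=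
  {d | ∃ (p : ProbabilityMeasure (T × Cotangent ρ T))
      (h : POVM.IsMixable (simpleMeasurement E) (p : Measure (T × Cotangent ρ T))),
      IsLocallyUnbiased ρ (POVM.mix (simpleMeasurement E) p h) ∧
      deviation ρ g (POVM.mix (simpleMeasurement E) p h) = d}

end Estimation

end QuantumEstimation

open QuantumEstimation QuantumEstimation.Cotangent

/-! Everything is transported to the purifying space of square summable families in `H` indexed by
the eigenbasis of `ρ`. There `ρ` becomes the vector `Ω = (√s_j φ_j)`, a class `X` becomes the vector
`X̂ = (√s_j X φ_j)`, and the SLD product becomes `Re ⟨X̂, Ŷ⟩`. The outcome law of a measurement `M`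
is `⟨Ω, (M(B) ⊗ 1) Ω⟩`, and `Re tr (M(B) (ρ ∘ X))` is `Re ⟨X̂, (M(B) ⊗ 1) Ω⟩`. Deviation and local
unbiasedness thus concern one positive measure and some signed measures attached to `Ω`
(`POVM.law_eq_diag_amp`, `POVM.re_trace_mul_jordan`).

For `M(x, X)` the spectral calculus gives all moments: a function `F` homogeneous of degree two has
expectation `F(x) ‖X̂‖²`, and a linear `f` integrated against the signed measure of a vector `y`
gives `f(x) Re ⟨y, X̂⟩`. Both formulas are averaged over `p` for a random measurement
(`lintegral_law_mixture`, `integral_offDiag_mixture`).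

Lower bound (`one_le_deviation`): local unbiasedness, contracted with `W` over an orthonormal basis,
says that the `p`-mean of `⟨W x, J X⟩` is `tr W = 1`. By Cauchy–Schwarz this integrand is at most
`‖W x‖ ‖X̂‖ ≤ (1 + g(x,x) ‖X̂‖²) / 2`, and the mean of the right side is `(1 + deviation) / 2`.

Upper bound: for an orthonormal eigenbasis `e_i` of `W` with eigenvalues `w_i`, and weights `a_i >
0` of sum `1`, choose the pair `(a_i⁻¹ e_i, J⁻¹ e_i)` with probability `a_i`. The result is locally
unbiased, since `a_i a_i⁻¹ = 1`, and its deviation is `∑ w_i² / a_i`. For `W > 0` the weights `a =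
w` give exactly `1`; in general, mixing `w` with the uniform weights gives values arbitrarily close
to `1`. -/

namespace QuantumEstimation

open Filter Topology
open scoped NNReal

variable {H : Type u} [NormedAddCommGroup H] [InnerProductSpace ℂ H] [CompleteSpace H]

/-! ### Integrals of simple functions against a measurement -/

namespace POVM

variable {Ω : Type*} [MeasurableSpace Ω]

theorem union (M : POVM Ω H) {A B : Set Ω} (hA : MeasurableSet A) (hB : MeasurableSet B)
    (hd : Disjoint A B) : M (A ∪ B) = M A + M B := by
  classical
  ext χ
  refine ext_inner_left ℂ fun ψ => ?_
  let f : ℕ → Set Ω := fun n => if n = 0 then A else if n = 1 then B else ∅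
  have hU : (⋃ n, f n) = A ∪ B := by
    ext x
    simp only [Set.mem_iUnion, Set.mem_union]
    constructor
    · rintro ⟨n, hn⟩
      simp only [f] at hn
      split_ifs at hn
      · exact Or.inl hn
      · exact Or.inr hn
      · exact hn.elim
    · rintro (hx | hx)
      · exact ⟨0, by simpa [f] using hx⟩
      · exact ⟨1, by simpa [f] using hx⟩
  have h := M.hasSum_iUnion f
    (fun n => by
      simp only [f]
      split_ifs
      exacts [hA, hB, MeasurableSet.empty])
    (fun m n hmn => by
      simp only [Function.onFun, f]
      split_ifs <;> first | omega | exact hd | exact hd.symm | simp)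
    ψ χ
  rw [hU] at h
  have h2 : HasSum (fun n => ⟪ψ, M (f n) χ⟫_ℂ) (∑ n ∈ Finset.range 2, ⟪ψ, M (f n) χ⟫_ℂ) := by
    refine hasSum_sum_of_ne_finset_zero fun n hn => ?_
    have : 1 < n := by simpa using hn
    have e : f n = ∅ := by simp only [f]; rw [if_neg (by omega), if_neg (by omega)]
    rw [e, M.empty]; simp
  rw [← h2.unique h]
  simp [Finset.sum_range_succ, f, inner_add_right]

/-- The operator `∫ q dM` for a simple function `q`. -/
noncomputable def simpleOp (M : POVM Ω H) (q : SimpleFunc Ω ℝ) : H →L[ℂ] H :=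
  q.setToSimpleFunc fun B => ContinuousLinearMap.toSpanSingleton ℝ (M B)

/-- The zero measure makes all finiteness conditions vacuous: a POVM is additive on all measurable
sets, and every simple function counts as integrable. -/
theorem finMeasAdditive (M : POVM Ω H) :
    FinMeasAdditive (0 : Measure Ω) fun B => ContinuousLinearMap.toSpanSingleton ℝ (M B) := by
  intro A B hA hB _ _ hd
  ext1
  simp [M.union hA hB hd]

theorem simpleOp_eq_sum (M : POVM Ω H) (q : SimpleFunc Ω ℝ) :
    M.simpleOp q = ∑ c ∈ q.range, c • M (q ⁻¹' {c}) := by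
  simp [simpleOp, SimpleFunc.setToSimpleFunc]

theorem simpleOp_sub (M : POVM Ω H) (q r : SimpleFunc Ω ℝ) :
    M.simpleOp (q - r) = M.simpleOp q - M.simpleOp r :=
  SimpleFunc.setToSimpleFunc_sub _ M.finMeasAdditive integrable_zero_measure
    integrable_zero_measure

theorem simpleOp_map {Ω' : Type*} [MeasurableSpace Ω'] (M : POVM Ω H) {φ : Ω → Ω'}
    (hφ : Measurable φ) (q : SimpleFunc Ω' ℝ) :
    (M.map φ hφ).simpleOp q = M.simpleOp (q.comp φ hφ) := by
  rw [simpleOp_eq_sum, simpleOp_eq_sum]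
  symm
  refine Finset.sum_subset (SimpleFunc.range_comp_subset_range q hφ) fun c _ hc => ?_
  have : (q.comp φ hφ) ⁻¹' {c} = ∅ := by
    rw [Set.eq_empty_iff_forall_notMem]
    intro x hx
    exact hc (SimpleFunc.mem_range.2 ⟨x, hx⟩)
  rw [this, M.empty, smul_zero]

theorem isSymmetric_simpleOp (M : POVM Ω H) (q : SimpleFunc Ω ℝ) (x y : H) :
    ⟪M.simpleOp q x, y⟫_ℂ = ⟪x, M.simpleOp q y⟫_ℂ := by
  have h : ∀ B, MeasurableSet B → ⟪M B x, y⟫_ℂ = ⟪x, M B y⟫_ℂ :=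
    fun B hB => (M.isPositive B hB).isSymmetric x y
  simp only [simpleOp_eq_sum, _root_.sum_apply, sum_inner, inner_sum]
  refine Finset.sum_congr rfl fun c _ => ?_
  have := h _ (q.measurableSet_fiber c)
  simp only [← Complex.coe_smul, _root_.smul_apply, inner_smul_left, inner_smul_right,
    Complex.conj_ofReal, this]

theorem diag_univ (M : POVM Ω H) (ψ : H) : M.diag ψ Set.univ = ENNReal.ofReal (‖ψ‖ ^ 2) := by
  rw [M.diag_apply ψ MeasurableSet.univ, M.univ, one_apply_eq_self,
    inner_self_eq_norm_sq_to_K]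
  norm_cast

instance (M : POVM Ω H) (ψ : H) : IsFiniteMeasure (M.diag ψ) :=
  ⟨by rw [M.diag_univ]; exact ENNReal.ofReal_lt_top⟩

theorem diag_real_apply (M : POVM Ω H) (ψ : H) {B : Set Ω} (hB : MeasurableSet B) :
    (M.diag ψ).real B = (⟪ψ, M B ψ⟫_ℂ).re := by
  rw [measureReal_def, M.diag_apply ψ hB, ENNReal.toReal_ofReal (M.re_inner_nonneg hB ψ)]

theorem re_inner_simpleOp (M : POVM Ω H) (q : SimpleFunc Ω ℝ) (ψ : H) :
    (⟪ψ, M.simpleOp q ψ⟫_ℂ).re = ∫ x, q x ∂M.diag ψ := by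
  rw [SimpleFunc.integral_eq_sum q (q.integrable_of_isFiniteMeasure), simpleOp_eq_sum,
    _root_.sum_apply, inner_sum, Complex.re_sum]
  refine Finset.sum_congr rfl fun c _ => ?_
  rw [M.diag_real_apply ψ (q.measurableSet_fiber c), ← Complex.coe_smul,
    _root_.smul_apply, inner_smul_right, Complex.re_ofReal_mul, smul_eq_mul, mul_comm]

/-- All effects are projections. -/
def IsProjective (M : POVM Ω H) : Prop := ∀ B, MeasurableSet B → IsIdempotentElem (M B)

/-- If `P`, `Q` and `P + Q` are idempotent, then `PQ + QP = 0`. Multiplying by `P` on either side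
gives `PQ = -PQP = QP`, hence `2PQ = 0`. -/
theorem IsProjective.mul_eq_zero {M : POVM Ω H} (hM : M.IsProjective) {A B : Set Ω}
    (hA : MeasurableSet A) (hB : MeasurableSet B) (hd : Disjoint A B) : M A * M B = 0 := by
  have hU := hM _ (hA.union hB)
  rw [M.union hA hB hd] at hU
  have a := hM A hA
  have b := hM B hB
  unfold IsIdempotentElem at hU a b
  have h1 : M A * M B + M B * M A = 0 := by
    have : (M A + M B) * (M A + M B) = M A * M A + M B * M B + (M A * M B + M B * M A) := by
      noncomm_ring
    rw [this, a, b] at hU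
    simpa using hU
  have h2 : M A * M B + M A * M B * M A = 0 := by
    calc M A * M B + M A * M B * M A = M A * M A * M B + M A * M B * M A := by rw [a]
      _ = M A * (M A * M B + M B * M A) := by noncomm_ring
      _ = 0 := by rw [h1, mul_zero]
  have h3 : M A * M B * M A + M B * M A = 0 := by
    calc M A * M B * M A + M B * M A = M A * M B * M A + M B * (M A * M A) := by rw [a]
      _ = (M A * M B + M B * M A) * M A := by noncomm_ring
      _ = 0 := by rw [h1, zero_mul]
  have h4 : M A * M B = M B * M A := by
    have := h2.trans h3.symm
    rw [add_comm] at this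
    exact add_left_cancel this
  rw [← h4] at h1
  have h5 : (2 : ℝ) • (M A * M B) = 0 := by rw [two_smul]; exact h1
  exact (smul_eq_zero.1 h5).resolve_left two_ne_zero

/-- The isometry of the functional calculus. Distinct fibres of `q` have orthogonal projections, so
the cross terms disappear from the square of the operator. -/
theorem IsProjective.norm_simpleOp_sq {M : POVM Ω H} (hM : M.IsProjective) (q : SimpleFunc Ω ℝ)
    (ψ : H) : ‖M.simpleOp q ψ‖ ^ 2 = ∫ x, q x ^ 2 ∂M.diag ψ := by
  have hsq : M.simpleOp q * M.simpleOp q = ∑ c ∈ q.range, (c ^ 2) • M (q ⁻¹' {c}) := by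
    rw [simpleOp_eq_sum, Finset.sum_mul_sum]
    refine Finset.sum_congr rfl fun c hc => ?_
    rw [Finset.sum_eq_single c]
    · rw [smul_mul_smul_comm, (hM _ (q.measurableSet_fiber c)).eq, sq]
    · intro d _ hd
      rw [smul_mul_smul_comm, hM.mul_eq_zero (q.measurableSet_fiber c) (q.measurableSet_fiber d),
        smul_zero]
      exact Disjoint.preimage _ (by simpa using hd.symm)
    · exact fun h => absurd hc h
  have h1 : ‖M.simpleOp q ψ‖ ^ 2 = (⟪ψ, (M.simpleOp q * M.simpleOp q) ψ⟫_ℂ).re := by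
    rw [mul_apply_eq_comp, ← isSymmetric_simpleOp, inner_self_eq_norm_sq_to_K]
    norm_cast
  have h2 : ∫ x, q x ^ 2 ∂M.diag ψ = ∑ c ∈ q.range, (M.diag ψ).real (q ⁻¹' {c}) * c ^ 2 := by
    have hi : Integrable q (M.diag ψ) := q.integrable_of_isFiniteMeasure
    have := SimpleFunc.map_integral q (fun c => c ^ 2) hi (by simp)
    rw [SimpleFunc.integral_eq_integral _ (SimpleFunc.integrable_of_isFiniteMeasure _)] at this
    simpa using this
  rw [h1, h2, hsq, _root_.sum_apply, inner_sum, Complex.re_sum]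
  refine Finset.sum_congr rfl fun c _ => ?_
  rw [M.diag_real_apply ψ (q.measurableSet_fiber c), ← Complex.coe_smul,
    _root_.smul_apply, inner_smul_right, Complex.re_ofReal_mul, mul_comm]

end POVM

end QuantumEstimation

/-! ### Recovering an unbounded operator from its spectral measure -/

namespace QuantumEstimation

open Filter Topology
open scoped NNReal

variable {H : Type u} [NormedAddCommGroup H] [InnerProductSpace ℂ H] [CompleteSpace H]

theorem POVM.inner_simpleOp {Ω : Type*} [MeasurableSpace Ω] (M : POVM Ω H) (q : SimpleFunc Ω ℝ)
    (ψ : H) : ⟪ψ, M.simpleOp q ψ⟫_ℂ = ((∫ x, q x ∂M.diag ψ : ℝ) : ℂ) := by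
  rw [← M.re_inner_simpleOp]
  refine (Complex.conj_eq_iff_re.1 ?_).symm
  rw [inner_conj_symm, M.isSymmetric_simpleOp]

/-- A sesquilinear form is recovered from its diagonal. -/
theorem inner_map_eq_polarization {H : Type*} [NormedAddCommGroup H] [InnerProductSpace ℂ H]
    {V : Type*} [AddCommGroup V] [Module ℂ V] (i D : V →ₗ[ℂ] H)
    (x y : V) : ⟪i x, D y⟫_ℂ =
      ((⟪i (y + x), D (y + x)⟫_ℂ - ⟪i y, D y⟫_ℂ - ⟪i x, D x⟫_ℂ) +
        Complex.I * (⟪i (y + Complex.I • x), D (y + Complex.I • x)⟫_ℂ - ⟪i y, D y⟫_ℂ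
          - ⟪i x, D x⟫_ℂ)) / 2 := by
  simp only [map_add, map_smul, inner_add_left, inner_add_right, inner_smul_left, inner_smul_right,
    Complex.conj_I]
  linear_combination ((⟪i x, D y⟫_ℂ - ⟪i y, D x⟫_ℂ + Complex.I * ⟪i x, D x⟫_ℂ) / 2) * Complex.I_sq

/-- Simple functions on `ℝ` that converge pointwise to the identity. -/
noncomputable def idApprox (n : ℕ) : SimpleFunc ℝ ℝ :=
  SimpleFunc.approxOn (fun x : ℝ => x) measurable_id Set.univ 0 trivial n

theorem abs_idApprox_le (n : ℕ) (t : ℝ) : |idApprox n t| ≤ 2 * |t| := by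
  have := SimpleFunc.norm_approxOn_zero_le (f := fun x : ℝ => x) measurable_id
    (s := Set.univ) trivial t n
  simpa [two_mul, idApprox] using this

theorem tendsto_idApprox (t : ℝ) : Tendsto (fun n => idApprox n t) atTop (𝓝 t) :=
  SimpleFunc.tendsto_approxOn (f := fun x : ℝ => x) measurable_id (s := Set.univ) trivial (by simp)

namespace IsSpectralMeasure

variable {X : H →ₗ.[ℂ] H} {E : POVM ℝ H}

theorem integrable_sq (hE : IsSpectralMeasure X E) (φ : X.domain) :
    Integrable (fun t : ℝ => t ^ 2) (E.diag (φ : H)) := by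
  refine ⟨by fun_prop, ?_⟩
  rw [hasFiniteIntegral_iff_ofReal (Eventually.of_forall fun t => sq_nonneg t)]
  exact (hE.mem_domain_iff _).1 φ.2

theorem integrable_id (hE : IsSpectralMeasure X E) (φ : X.domain) :
    Integrable (fun t : ℝ => t) (E.diag (φ : H)) := by
  have : MemLp (fun t : ℝ => t) 2 (E.diag (φ : H)) :=
    (memLp_two_iff_integrable_sq (by fun_prop)).2 (hE.integrable_sq φ)
  exact this.integrable one_le_two

variable {q : ℕ → SimpleFunc ℝ ℝ} {C r : ℝ}

/-- By the isometry, distances are `L²` distances for the diagonal measure of `φ`. These tend to `0`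
by dominated convergence, since `t²` is integrable exactly on the domain of `X`. -/
theorem cauchySeq_simpleOp (hE : IsSpectralMeasure X E) (hq : ∀ n t, |q n t| ≤ C * |t|)
    (hr : ∀ t, Tendsto (fun n => q n t) atTop (𝓝 (r * t))) (φ : X.domain) :
    CauchySeq fun n => E.simpleOp (q n) (φ : H) := by
  rw [cauchySeq_iff_tendsto_dist_atTop_0]
  have e : ∀ n : ℕ × ℕ, dist (E.simpleOp (q n.1) (φ : H)) (E.simpleOp (q n.2) (φ : H)) =
      √(∫ t, (q n.1 t - q n.2 t) ^ 2 ∂E.diag (φ : H)) := by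
    intro n
    rw [dist_eq_norm, ← _root_.sub_apply, ← E.simpleOp_sub]
    refine (Real.sqrt_eq_iff_mul_self_eq (integral_nonneg fun t => sq_nonneg _)
      (norm_nonneg _)).2 ?_ |>.symm
    rw [← sq, POVM.IsProjective.norm_simpleOp_sq hE.isIdempotentElem]
    simp
  simp only [e]
  rw [← Real.sqrt_zero]
  refine (Real.continuous_sqrt.tendsto 0).comp ?_
  have h0 : (0 : ℝ) = ∫ t, (0 : ℝ) ∂E.diag (φ : H) := by simp
  rw [h0]
  refine tendsto_integral_filter_of_dominated_convergence (fun t => (2 * C) ^ 2 * t ^ 2)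
    (Eventually.of_forall fun n => ?_) (Eventually.of_forall fun n => Eventually.of_forall fun t => ?_)
    ((hE.integrable_sq φ).const_mul _) (Eventually.of_forall fun t => ?_)
  · exact (((q n.1).measurable.sub (q n.2).measurable).pow_const 2).aestronglyMeasurable
  · rw [Real.norm_eq_abs, abs_of_nonneg (sq_nonneg _), ← mul_pow]
    refine sq_le_sq.2 ?_
    calc |q n.1 t - q n.2 t| ≤ |q n.1 t| + |q n.2 t| := abs_sub _ _
      _ ≤ C * |t| + C * |t| := add_le_add (hq _ _) (hq _ _)
      _ = (2 * C) * |t| := by ring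
      _ ≤ |2 * C| * |t| := by gcongr; exact le_abs_self _
      _ = |2 * C * t| := (abs_mul _ _).symm
  · have h1 : Tendsto (fun n : ℕ × ℕ => q n.1 t) atTop (𝓝 (r * t)) :=
      (hr t).comp (by rw [← prod_atTop_atTop_eq]; exact tendsto_fst)
    have h2 : Tendsto (fun n : ℕ × ℕ => q n.2 t) atTop (𝓝 (r * t)) :=
      (hr t).comp (by rw [← prod_atTop_atTop_eq]; exact tendsto_snd)
    simpa using (h1.sub h2).pow 2

/-- `IsSpectralMeasure` prescribes only the quadratic form of `X`. The strong limit exists by the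
Cauchy property; polarization on the domain identifies it weakly, and density of the domain then
determines it. The factor `r` serves the image measurement under `t ↦ t x`, where a functional `f`
sees `t f(x)`. -/
theorem tendsto_simpleOp (hE : IsSpectralMeasure X E) (hX : Dense (X.domain : Set H))
    (hq : ∀ n t, |q n t| ≤ C * |t|)
    (hr : ∀ t, Tendsto (fun n => q n t) atTop (𝓝 (r * t))) (φ : X.domain) :
    Tendsto (fun n => E.simpleOp (q n) (φ : H)) atTop (𝓝 ((r : ℂ) • X φ)) := by
  obtain ⟨z, hz⟩ := cauchySeq_tendsto_of_complete (hE.cauchySeq_simpleOp hq hr φ)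
  have hdiag : ∀ χ : X.domain, Tendsto (fun n => ⟪(χ : H), E.simpleOp (q n) (χ : H)⟫_ℂ) atTop
      (𝓝 ⟪(χ : H), (r : ℂ) • X χ⟫_ℂ) := by
    intro χ
    simp only [E.inner_simpleOp]
    rw [inner_smul_right, hE.inner_apply, ← Complex.ofReal_mul, ← integral_const_mul]
    refine (Complex.continuous_ofReal.tendsto _).comp ?_
    refine tendsto_integral_of_dominated_convergence (fun t => C * |t|)
      (fun n => (q n).measurable.aestronglyMeasurable) ((hE.integrable_id χ).abs.const_mul C)
      (fun n => Eventually.of_forall fun t => hq n t) (Eventually.of_forall hr)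
  let D : ℕ → X.domain →ₗ[ℂ] H := fun n =>
    (E.simpleOp (q n) : H →ₗ[ℂ] H) ∘ₗ X.domain.subtype - (r : ℂ) • X.toFun
  have hD : ∀ n χ, D n χ = E.simpleOp (q n) (χ : H) - (r : ℂ) • X χ := fun n χ => rfl
  have hD0 : ∀ χ : X.domain, Tendsto (fun n => ⟪X.domain.subtype χ, D n χ⟫_ℂ) atTop (𝓝 0) := by
    intro χ
    have := (hdiag χ).sub_const ⟪(χ : H), (r : ℂ) • X χ⟫_ℂ
    rw [sub_self] at this
    refine this.congr fun n => ?_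
    rw [hD, inner_sub_right]
    rfl
  have hD1 : ∀ χ : X.domain, Tendsto (fun n => ⟪X.domain.subtype χ, D n φ⟫_ℂ) atTop (𝓝 0) := by
    intro χ
    have := ((((hD0 (φ + χ)).sub (hD0 φ)).sub (hD0 χ)).add
      ((((hD0 (φ + Complex.I • χ)).sub (hD0 φ)).sub (hD0 χ)).const_mul Complex.I)).div_const 2
    simp only [← inner_map_eq_polarization] at this
    simpa using this
  have hz0 : z - (r : ℂ) • X φ = 0 := by
    refine hX.eq_zero_of_inner_right (𝕜 := ℂ) fun {χ} hχ => ?_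
    refine tendsto_nhds_unique ?_ (hD1 ⟨χ, hχ⟩)
    refine (Continuous.tendsto (by fun_prop : Continuous fun w : H => ⟪χ, w⟫_ℂ) _).comp
      (hz.sub_const _)
  rw [sub_eq_zero.1 hz0] at hz
  exact hz

theorem integral_sq (hE : IsSpectralMeasure X E) (hX : Dense (X.domain : Set H)) (φ : X.domain) :
    ∫ t, t ^ 2 ∂E.diag (φ : H) = ‖X φ‖ ^ 2 := by
  have h1 := (hE.tendsto_simpleOp hX abs_idApprox_le
    (fun t => by simpa using tendsto_idApprox t) (r := 1) φ).norm.pow 2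
  simp only [POVM.IsProjective.norm_simpleOp_sq hE.isIdempotentElem, Complex.ofReal_one,
    one_smul] at h1
  refine tendsto_nhds_unique ?_ h1
  refine tendsto_integral_of_dominated_convergence (fun t => 2 ^ 2 * t ^ 2)
    (fun n => ((SimpleFunc.measurable _).pow_const 2).aestronglyMeasurable)
    ((hE.integrable_sq φ).const_mul _) (fun n => Eventually.of_forall fun t => ?_)
    (Eventually.of_forall fun t => (tendsto_idApprox t).pow 2)
  rw [Real.norm_eq_abs, abs_of_nonneg (sq_nonneg _), ← mul_pow]
  refine sq_le_sq.2 ?_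
  simpa [abs_mul] using abs_idApprox_le n t

theorem lintegral_sq (hE : IsSpectralMeasure X E) (hX : Dense (X.domain : Set H)) (φ : X.domain) :
    ∫⁻ t, ENNReal.ofReal (t ^ 2) ∂E.diag (φ : H) = ENNReal.ofReal (‖X φ‖ ^ 2) := by
  rw [← ofReal_integral_eq_lintegral_ofReal (hE.integrable_sq φ)
    (Eventually.of_forall fun t => sq_nonneg t), hE.integral_sq hX]

theorem norm_simpleOp_le (hE : IsSpectralMeasure X E) (hX : Dense (X.domain : Set H))
    {q : SimpleFunc ℝ ℝ} (hC : 0 ≤ C) (hq : ∀ t, |q t| ≤ C * |t|) (φ : X.domain) :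
    ‖E.simpleOp q (φ : H)‖ ≤ C * ‖X φ‖ := by
  refine (pow_le_pow_iff_left₀ (norm_nonneg _) (by positivity) two_ne_zero).1 ?_
  rw [POVM.IsProjective.norm_simpleOp_sq hE.isIdempotentElem, mul_pow, ← hE.integral_sq hX,
    ← integral_const_mul]
  have hi : Integrable (q.map fun c => c ^ 2) (E.diag (φ : H)) :=
    SimpleFunc.integrable_of_isFiniteMeasure _
  refine integral_mono hi ((hE.integrable_sq φ).const_mul _) fun t => ?_
  change q t ^ 2 ≤ C ^ 2 * t ^ 2
  rw [← mul_pow]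
  refine sq_le_sq.2 ?_
  rw [abs_mul, abs_of_nonneg hC]
  exact hq t

end IsSpectralMeasure

end QuantumEstimation

/-! ### Off-diagonal signed measures and weak mixtures -/

namespace QuantumEstimation

open Filter Topology
open scoped NNReal

variable {H : Type u} [NormedAddCommGroup H] [InnerProductSpace ℂ H] [CompleteSpace H]

/-- An average of measures given setwise is given on all measurable functions. -/
theorem lintegral_of_forall_measurableSet {Ω S : Type*} [MeasurableSpace Ω] [MeasurableSpace S]
    {p : Measure S} {ν : Measure Ω} {k : S → Measure Ω}
    (hk : ∀ B, MeasurableSet B → AEMeasurable (fun s => k s B) p ∧ ν B = ∫⁻ s, k s B ∂p)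
    {F : Ω → ℝ≥0∞} (hF : Measurable F) :
    AEMeasurable (fun s => ∫⁻ x, F x ∂k s) p ∧ ∫⁻ x, F x ∂ν = ∫⁻ s, ∫⁻ x, F x ∂k s ∂p := by
  -- Measurability in `s` holds only `p`-almost everywhere, with a null set depending on `B`, so `k`
  -- need not be a kernel. The induction carries a.e. measurability along with the identity.
  refine Measurable.ennreal_induction (motive := fun F => AEMeasurable (fun s => ∫⁻ x, F x ∂k s) p ∧
    ∫⁻ x, F x ∂ν = ∫⁻ s, ∫⁻ x, F x ∂k s ∂p) ?_ ?_ ?_ hF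
  · intro c B hB
    simp only [lintegral_indicator_const hB]
    exact ⟨(hk _ hB).1.const_mul c, by rw [(hk _ hB).2, lintegral_const_mul'' _ (hk _ hB).1]⟩
  · intro f g _ hf hg ihf ihg
    simp only [Pi.add_apply, lintegral_add_left hf]
    exact ⟨ihf.1.add ihg.1, by rw [ihf.2, ihg.2, lintegral_add_left' ihf.1]⟩
  · intro f hf hm ih
    simp only [lintegral_iSup hf hm]
    refine ⟨AEMeasurable.iSup fun n => (ih n).1, ?_⟩
    rw [lintegral_iSup' (fun n => (ih n).1)]
    · simp only [fun n => (ih n).2]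
    · exact Eventually.of_forall fun s i j hij => lintegral_mono (hm hij)

namespace POVM

variable {Ω : Type*} [MeasurableSpace Ω]

/-- The signed measure `B ↦ Re ⟨ψ, M(B) φ⟩`. -/
noncomputable def offDiag (M : POVM Ω H) (φ ψ : H) : SignedMeasure Ω :=
  (1 / 4 : ℝ) • ((M.diag (φ + ψ)).toSignedMeasure - (M.diag (φ - ψ)).toSignedMeasure)

theorem re_inner_symm (M : POVM Ω H) {B : Set Ω} (hB : MeasurableSet B) (φ ψ : H) :
    (⟪φ, M B ψ⟫_ℂ).re = (⟪ψ, M B φ⟫_ℂ).re := by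
  have h : ⟪M B φ, ψ⟫_ℂ = ⟪φ, M B ψ⟫_ℂ := (M.isPositive B hB).isSymmetric φ ψ
  rw [← h, ← inner_conj_symm, Complex.conj_re]

theorem offDiag_apply (M : POVM Ω H) (φ ψ : H) {B : Set Ω} (hB : MeasurableSet B) :
    M.offDiag φ ψ B = (⟪ψ, M B φ⟫_ℂ).re := by
  have := M.re_inner_symm hB φ ψ
  simp only [offDiag, _root_.smul_apply, _root_.sub_apply,
    Measure.toSignedMeasure_apply_measurable hB, M.diag_real_apply _ hB, map_add, map_sub,
    inner_add_left, inner_add_right, inner_sub_left, inner_sub_right, Complex.add_re,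
    Complex.sub_re, this, smul_eq_mul]
  ring

/-- Cauchy–Schwarz in additive form: `c ⟨ψ, M(B) φ⟩ = ⟨ψ, M(B) cφ⟩` is bounded by the diagonal terms
of `cφ` and `ψ`. Setwise bounds of this kind pass to the variation. -/
theorem smul_variation_offDiag_le (M : POVM Ω H) (φ ψ : H) (c : ℝ≥0) :
    c • (M.offDiag φ ψ).variation ≤ (c ^ 2) • M.diag φ + M.diag ψ := by
  rw [← Real.toNNReal_coe (r := c)]
  have e : (Real.toNNReal (c : ℝ)) • (M.offDiag φ ψ).variation =
      ((c : ℝ) • M.offDiag φ ψ).variation := by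
    rw [VectorMeasure.variation_smul]
    congr 1
    ext; simp
  rw [e]
  refine VectorMeasure.variation_le_of_forall_enorm_le fun B hB => ?_
  have h1 := M.norm_inner_le_half hB ψ ((c : ℂ) • φ)
  have h2 : |(⟪ψ, M B ((c : ℂ) • φ)⟫_ℂ).re| ≤ ‖⟪ψ, M B ((c : ℂ) • φ)⟫_ℂ‖ :=
    Complex.abs_re_le_norm _
  have h3 : 0 ≤ (c : ℝ) ^ 2 * (⟪φ, M B φ⟫_ℂ).re :=
    mul_nonneg (sq_nonneg _) (M.re_inner_nonneg hB φ)
  have h4 : 0 ≤ (⟪ψ, M B ψ⟫_ℂ).re := M.re_inner_nonneg hB ψ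
  have e1 : (⟪ψ, M B ((c : ℂ) • φ)⟫_ℂ).re = c * (⟪ψ, M B φ⟫_ℂ).re := by
    rw [map_smul, inner_smul_right, ← Complex.re_ofReal_mul]
  have e2 : (⟪(c : ℂ) • φ, M B ((c : ℂ) • φ)⟫_ℂ).re = c ^ 2 * (⟪φ, M B φ⟫_ℂ).re := by
    have : ((c : ℝ≥0) : ℂ) = ((c : ℝ) : ℂ) := rfl
    rw [map_smul, inner_smul_right, inner_smul_left, this, Complex.conj_ofReal,
      Complex.re_ofReal_mul, Complex.re_ofReal_mul]
    ring
  rw [e1] at h2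
  rw [e2] at h1
  rw [_root_.smul_apply, M.offDiag_apply φ ψ hB, Measure.add_apply, Measure.smul_apply,
    M.diag_apply φ hB, M.diag_apply ψ hB, Real.enorm_eq_ofReal_abs, smul_eq_mul]
  have e3 : (Real.toNNReal (c : ℝ) ^ 2) • ENNReal.ofReal (⟪φ, M B φ⟫_ℂ).re =
      ENNReal.ofReal ((c : ℝ) ^ 2 * (⟪φ, M B φ⟫_ℂ).re) := by
    rw [ENNReal.ofReal_mul (sq_nonneg _), Real.toNNReal_coe, ENNReal.smul_def, smul_eq_mul]
    congr 1
    rw [ENNReal.ofReal_pow (NNReal.coe_nonneg c), ENNReal.ofReal_coe_nnreal, ENNReal.coe_pow]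
  rw [e3, ← ENNReal.ofReal_add h3 h4]
  exact ENNReal.ofReal_le_ofReal (by linarith)

/-- For a simple function below `F`, the previous bound is applied on each fibre with `c` equal to
the value taken there. Hence a finite second moment in `φ` suffices for a first moment of the
off-diagonal measure, whatever `ψ` is. -/
theorem lintegral_variation_offDiag_le (M : POVM Ω H) (φ ψ : H) (F : Ω → ℝ≥0∞) :
    ∫⁻ x, F x ∂(M.offDiag φ ψ).variation ≤ ∫⁻ x, F x ^ 2 ∂M.diag φ + M.diag ψ Set.univ := by
  rw [lintegral_eq_nnreal]
  refine iSup₂_le fun q hq => ?_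
  have h1 : ∫⁻ x, F x ^ 2 ∂M.diag φ ≥ ∫⁻ x, ((q x : ℝ≥0∞)) ^ 2 ∂M.diag φ :=
    lintegral_mono fun x => by gcongr; exact hq x
  have h2 : ∫⁻ x, ((q x : ℝ≥0∞)) ^ 2 ∂M.diag φ =
      ∑ c ∈ q.range, (c : ℝ≥0∞) ^ 2 * M.diag φ (q ⁻¹' {c}) := by
    rw [← SimpleFunc.map_lintegral (fun c : ℝ≥0 => (c : ℝ≥0∞) ^ 2)]
    exact SimpleFunc.lintegral_eq_lintegral (q.map fun c : ℝ≥0 => (c : ℝ≥0∞) ^ 2) (M.diag φ)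
  have h3 : M.diag ψ Set.univ = ∑ c ∈ q.range, M.diag ψ (q ⁻¹' {c}) :=
    (q.sum_range_measure_preimage_singleton _).symm
  rw [h3]
  refine le_trans ?_ (add_le_add h1 le_rfl)
  rw [h2, SimpleFunc.map_lintegral, ← Finset.sum_add_distrib]
  refine Finset.sum_le_sum fun c _ => ?_
  have := M.smul_variation_offDiag_le φ ψ c (q ⁻¹' {c})
  rw [Measure.add_apply, Measure.smul_apply, Measure.smul_apply, ENNReal.smul_def, ENNReal.smul_def,
    smul_eq_mul, smul_eq_mul, ENNReal.coe_pow] at this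
  exact this

theorem integrable_offDiag (M : POVM Ω H) (φ ψ : H) {G : Type*} [NormedAddCommGroup G]
    {f : Ω → G} (hf : StronglyMeasurable f) (hf2 : ∫⁻ x, ‖f x‖ₑ ^ 2 ∂M.diag φ < ∞) :
    (M.offDiag φ ψ).Integrable f := by
  refine ⟨hf.aestronglyMeasurable, ?_⟩
  refine (M.lintegral_variation_offDiag_le φ ψ _).trans_lt ?_
  exact ENNReal.add_lt_top.2 ⟨hf2, measure_lt_top _ _⟩

theorem integral_simpleFunc_offDiag (M : POVM Ω H) (φ ψ : H) (q : SimpleFunc Ω ℝ) :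
    ∫ᵛ x, q x ∂<•M.offDiag φ ψ = (⟪ψ, M.simpleOp q φ⟫_ℂ).re := by
  have hi : ∀ χ : H, (M.diag χ).toSignedMeasure.Integrable q := fun χ => by
    rw [VectorMeasure.Integrable, Measure.variation_toSignedMeasure]
    exact q.integrable_of_isFiniteMeasure
  have hs : (⟪φ, M.simpleOp q ψ⟫_ℂ).re = (⟪ψ, M.simpleOp q φ⟫_ℂ).re := by
    rw [← M.isSymmetric_simpleOp, ← inner_conj_symm, Complex.conj_re]
  rw [offDiag, VectorMeasure.integral_smul_vectorMeasure,
    VectorMeasure.integral_sub_vectorMeasure (hi _) (hi _),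
    VectorMeasure.integral_toSignedMeasure, VectorMeasure.integral_toSignedMeasure,
    ← M.re_inner_simpleOp, ← M.re_inner_simpleOp]
  simp only [map_add, map_sub, inner_add_left, inner_add_right, inner_sub_left, inner_sub_right,
    Complex.add_re, Complex.sub_re, hs, smul_eq_mul]
  ring

/-- `M` is the weak integral `∫ κ s p(ds)`. -/
def IsMixture {S : Type*} [MeasurableSpace S] (κ : S → POVM Ω H) (p : Measure S)
    (M : POVM Ω H) : Prop :=
  IsMixable κ p ∧ ∀ B, MeasurableSet B → ∀ ψ χ : H, ⟪ψ, M B χ⟫_ℂ = ∫ s, ⟪ψ, κ s B χ⟫_ℂ ∂p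

theorem isMixture_mix {S : Type*} [MeasurableSpace S] (κ : S → POVM Ω H) (p : Measure S)
    [IsProbabilityMeasure p] (h : IsMixable κ p) : IsMixture κ p (mix κ p h) :=
  ⟨h, fun _ hB ψ χ => inner_mixFun κ p h hB ψ χ⟩

namespace IsMixture

variable {S : Type*} [MeasurableSpace S] {κ : S → POVM Ω H} {p : Measure S}
  [IsProbabilityMeasure p] {M : POVM Ω H}

theorem lintegral_diag (hM : IsMixture κ p M) (ψ : H) {F : Ω → ℝ≥0∞} (hF : Measurable F) :
    AEMeasurable (fun s => ∫⁻ x, F x ∂(κ s).diag ψ) p ∧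
      ∫⁻ x, F x ∂M.diag ψ = ∫⁻ s, ∫⁻ x, F x ∂(κ s).diag ψ ∂p := by
  refine lintegral_of_forall_measurableSet (fun B hB => ?_) hF
  simp only [diag_apply _ ψ hB]
  have hi : Integrable (fun s => (⟪ψ, κ s B ψ⟫_ℂ).re) p := (hM.1.integrable hB ψ ψ).re
  refine ⟨hi.aestronglyMeasurable.aemeasurable.ennreal_ofReal, ?_⟩
  rw [hM.2 B hB, ← ofReal_integral_eq_lintegral_ofReal hi
    (Eventually.of_forall fun s => (κ s).re_inner_nonneg hB ψ)]
  congr 1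
  exact (integral_re (hM.1.integrable hB ψ ψ)).symm

theorem re_inner_simpleOp (hM : IsMixture κ p M) (φ ψ : H) (q : SimpleFunc Ω ℝ) :
    Integrable (fun s => (⟪ψ, (κ s).simpleOp q φ⟫_ℂ).re) p ∧
      (⟪ψ, M.simpleOp q φ⟫_ℂ).re = ∫ s, (⟪ψ, (κ s).simpleOp q φ⟫_ℂ).re ∂p := by
  have e : ∀ N : POVM Ω H, (⟪ψ, N.simpleOp q φ⟫_ℂ).re =
      ∑ c ∈ q.range, c * (⟪ψ, N (q ⁻¹' {c}) φ⟫_ℂ).re := by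
    intro N
    rw [simpleOp_eq_sum, _root_.sum_apply, inner_sum, Complex.re_sum]
    refine Finset.sum_congr rfl fun c _ => ?_
    rw [← Complex.coe_smul, _root_.smul_apply, inner_smul_right, Complex.re_ofReal_mul]
  have hi : ∀ c ∈ q.range, Integrable (fun s => c * (⟪ψ, κ s (q ⁻¹' {c}) φ⟫_ℂ).re) p :=
    fun c _ => (hM.1.integrable (q.measurableSet_fiber c) ψ φ).re.const_mul c
  simp only [e]
  refine ⟨integrable_finsetSum _ hi, ?_⟩
  rw [integral_finsetSum _ hi]
  refine Finset.sum_congr rfl fun c _ => ?_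
  rw [integral_const_mul, hM.2 _ (q.measurableSet_fiber c)]
  congr 1
  exact (integral_re (hM.1.integrable (q.measurableSet_fiber c) ψ φ)).symm

/-- For simple functions the integral commutes with the mixture because only finitely many effects
occur. The approximations `idApprox n ∘ f` reduce `f` to this case, with dominated convergence on
both sides: by `2|f|` for the signed measure and by `‖ψ‖ b` for `p`. -/
theorem integral_offDiag (hM : IsMixture κ p M) {f : Ω → ℝ} (hf : Measurable f) {φ ψ : H}
    (hi : (M.offDiag φ ψ).Integrable f) {b v : S → ℝ} (hb : Integrable b p)
    (hκb : ∀ n s, ‖(κ s).simpleOp ((idApprox n).comp f hf) φ‖ ≤ b s)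
    (hκv : ∀ s, Tendsto (fun n => (⟪ψ, (κ s).simpleOp ((idApprox n).comp f hf) φ⟫_ℂ).re) atTop
      (𝓝 (v s))) :
    Integrable v p ∧ ∫ᵛ x, f x ∂<•M.offDiag φ ψ = ∫ s, v s ∂p := by
  have hbd : ∀ n, ∀ᵐ s ∂p, ‖(⟪ψ, (κ s).simpleOp ((idApprox n).comp f hf) φ⟫_ℂ).re‖ ≤
      ‖ψ‖ * b s := fun n => Eventually.of_forall fun s => by
    refine (Complex.abs_re_le_norm _).trans ((norm_inner_le_norm _ _).trans ?_)
    gcongr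
    exact hκb n s
  have hm : ∀ n, AEStronglyMeasurable
      (fun s => (⟪ψ, (κ s).simpleOp ((idApprox n).comp f hf) φ⟫_ℂ).re) p :=
    fun n => (hM.re_inner_simpleOp φ ψ _).1.aestronglyMeasurable
  have hv : Integrable v p := by
    refine (hb.const_mul ‖ψ‖).mono' (aestronglyMeasurable_of_tendsto_ae atTop hm
      (Eventually.of_forall hκv)) (Eventually.of_forall fun s => ?_)
    refine le_of_tendsto (hκv s).norm (Eventually.of_forall fun n => ?_)
    refine (Complex.abs_re_le_norm _).trans ((norm_inner_le_norm _ _).trans ?_)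
    gcongr
    exact hκb n s
  refine ⟨hv, ?_⟩
  have h1 : Tendsto (fun n => ∫ᵛ x, (idApprox n).comp f hf x ∂<•M.offDiag φ ψ) atTop
      (𝓝 (∫ᵛ x, f x ∂<•M.offDiag φ ψ)) := by
    refine VectorMeasure.tendsto_integral_of_dominated_convergence (fun x => 2 * |f x|)
      (fun n => (SimpleFunc.measurable _).aestronglyMeasurable) (hi.abs.const_mul 2)
      (fun n => Eventually.of_forall fun x => abs_idApprox_le n (f x))
      (Eventually.of_forall fun x => tendsto_idApprox (f x))
  have h2 : Tendsto (fun n => ∫ s, (⟪ψ, (κ s).simpleOp ((idApprox n).comp f hf) φ⟫_ℂ).re ∂p) atTop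
      (𝓝 (∫ s, v s ∂p)) :=
    tendsto_integral_of_dominated_convergence (fun s => ‖ψ‖ * b s) hm (hb.const_mul _) hbd
      (Eventually.of_forall hκv)
  refine tendsto_nhds_unique h1 (h2.congr fun n => ?_)
  rw [← (hM.re_inner_simpleOp φ ψ _).2, integral_simpleFunc_offDiag]

end IsMixture

end POVM

end QuantumEstimation

/-! ### Square summable families and amplified measurements -/

namespace QuantumEstimation

open Filter Topology
open scoped NNReal

/-- The space of Hilbert–Schmidt families `ι → H`, the Hilbert sum of copies of `H`. -/
abbrev Amp (ι : Type*) (H : Type*) [NormedAddCommGroup H] : Type _ := lp (fun _ : ι => H) 2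

namespace Amp

variable {ι : Type*} {H : Type*} [NormedAddCommGroup H]

theorem summable_norm_sq (z : Amp ι H) : Summable fun j => ‖z j‖ ^ 2 := by
  have := (lp.memℓp z).summable (by norm_num)
  simpa using this

theorem norm_sq_eq_tsum (z : Amp ι H) : ‖z‖ ^ 2 = ∑' j, ‖z j‖ ^ 2 := by
  have := lp.norm_rpow_eq_tsum (p := 2) (by norm_num) z
  simpa using this

theorem norm_le_of_forall_norm_le {z w : Amp ι H} {C : ℝ} (hC : 0 ≤ C)
    (h : ∀ j, ‖z j‖ ≤ C * ‖w j‖) : ‖z‖ ≤ C * ‖w‖ := by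
  refine (pow_le_pow_iff_left₀ (norm_nonneg _) (by positivity) two_ne_zero).1 ?_
  rw [mul_pow, norm_sq_eq_tsum, norm_sq_eq_tsum, ← tsum_mul_left]
  refine (summable_norm_sq z).tsum_le_tsum (fun j => ?_) ((summable_norm_sq w).mul_left _)
  rw [← mul_pow]
  exact pow_le_pow_left₀ (norm_nonneg _) (h j) 2

theorem tsum_norm_mul_norm_le (z w : Amp ι H) :
    (Summable fun j => ‖z j‖ * ‖w j‖) ∧ ∑' j, ‖z j‖ * ‖w j‖ ≤ ‖z‖ * ‖w‖ :=
  lp.tsum_mul_le_mul_norm (by rw [Real.holderConjugate_iff]; norm_num) z w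

theorem countable_support (z : Amp ι H) : {j | z j ≠ 0}.Countable := by
  have := (summable_norm_sq z).countable_support
  refine this.mono fun j hj => ?_
  simpa using hj

variable [InnerProductSpace ℂ H]

/-- The operator `A ⊗ 1`. -/
noncomputable def op (ι : Type*) (A : H →L[ℂ] H) : Amp ι H →L[ℂ] Amp ι H :=
  LinearMap.mkContinuous
    { toFun := fun z => ⟨fun j => A (z j),
        ((lp.memℓp z).norm.const_mul ‖A‖).mono fun j => A.le_opNorm _⟩
      map_add' := fun z w => by ext j; exact map_add A _ _
      map_smul' := fun c z => by ext j; exact map_smul A _ _ } ‖A‖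
    fun z => norm_le_of_forall_norm_le (norm_nonneg _) fun j => A.le_opNorm _

@[simp]
theorem op_apply (A : H →L[ℂ] H) (z : Amp ι H) (j : ι) : op ι A z j = A (z j) := rfl

theorem hasSum_inner_op (A : H →L[ℂ] H) (z w : Amp ι H) :
    HasSum (fun j => ⟪z j, A (w j)⟫_ℂ) ⟪z, op ι A w⟫_ℂ := lp.hasSum_inner z (op ι A w)

theorem op_one : op ι (1 : H →L[ℂ] H) = 1 := by
  ext z j
  simp

theorem op_isPositive [CompleteSpace H] {A : H →L[ℂ] H} (hA : A.IsPositive) :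
    (op ι A).IsPositive := by
  rw [ContinuousLinearMap.isPositive_iff_complex] at hA ⊢
  intro z
  have h1 : HasSum (fun j => ⟪A (z j), z j⟫_ℂ) ⟪op ι A z, z⟫_ℂ := lp.hasSum_inner (op ι A z) z
  have h2 := Complex.hasSum_re h1
  have h3 : HasSum (fun j => ⟪A (z j), z j⟫_ℂ) ((⟪op ι A z, z⟫_ℂ).re : ℂ) := by
    convert! Complex.hasSum_ofReal.2 h2 using 2 with j
    exact (hA (z j)).1.symm
  exact ⟨h3.unique h1, h2.nonneg fun j => (hA (z j)).2⟩

end Amp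

namespace POVM

variable {H : Type u} [NormedAddCommGroup H] [InnerProductSpace ℂ H] [CompleteSpace H]
variable {Ω : Type*} [MeasurableSpace Ω] {ι : Type u}

/-- The measurement `M ⊗ 1`. -/
noncomputable def amp (ι : Type u) (M : POVM Ω H) : POVM Ω (Amp ι H) where
  toFun B := Amp.op ι (M B)
  isPositive B hB := Amp.op_isPositive (M.isPositive B hB)
  univ := by rw [M.univ, Amp.op_one]
  hasSum_iUnion f hf hd z w := by
    have hnn : ∀ n j, 0 ≤ ((⟪z j, M (f n) (z j)⟫_ℂ).re + (⟪w j, M (f n) (w j)⟫_ℂ).re) / 2 :=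
      fun n j => by
        have := M.re_inner_nonneg (hf n) (z j)
        have := M.re_inner_nonneg (hf n) (w j)
        positivity
    have hU : MeasurableSet (⋃ n, f n) := MeasurableSet.iUnion hf
    have hj : ∀ j, HasSum
        (fun n => ((⟪z j, M (f n) (z j)⟫_ℂ).re + (⟪w j, M (f n) (w j)⟫_ℂ).re) / 2)
        (((⟪z j, M (⋃ n, f n) (z j)⟫_ℂ).re + (⟪w j, M (⋃ n, f n) (w j)⟫_ℂ).re) / 2) := fun j =>
      ((Complex.hasSum_re (M.hasSum_iUnion f hf hd (z j) (z j))).add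
        (Complex.hasSum_re (M.hasSum_iUnion f hf hd (w j) (w j)))).div_const 2
    -- Absolute summability over all pairs, from the diagonal terms of `z` and `w`, permits summing
    -- over `ι` and `ℕ` in either order.
    have hs : Summable fun a : ι × ℕ => ⟪z a.1, M (f a.2) (w a.1)⟫_ℂ := by
      refine Summable.of_norm_bounded (g := fun a : ι × ℕ =>
        ((⟪z a.1, M (f a.2) (z a.1)⟫_ℂ).re + (⟪w a.1, M (f a.2) (w a.1)⟫_ℂ).re) / 2) ?_
        fun a => M.norm_inner_le_half (hf a.2) _ _
      rw [summable_prod_of_nonneg fun a => hnn a.2 a.1]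
      refine ⟨fun j => (hj j).summable, ?_⟩
      simp only [fun j => (hj j).tsum_eq]
      exact (((Complex.hasSum_re (Amp.hasSum_inner_op (M (⋃ n, f n)) z z)).add
        (Complex.hasSum_re (Amp.hasSum_inner_op (M (⋃ n, f n)) w w))).div_const 2).summable
    have h1 := hs.hasSum.prod_fiberwise fun j => M.hasSum_iUnion f hf hd (z j) (w j)
    have h2 := h1.unique (Amp.hasSum_inner_op (M (⋃ n, f n)) z w)
    have h3 := hs.prod_symm.hasSum.prod_fiberwise fun n => Amp.hasSum_inner_op (M (f n)) z w
    rw [← h2, ← (Equiv.prodComm ι ℕ).symm.tsum_eq]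
    exact h3

theorem amp_apply (M : POVM Ω H) (B : Set Ω) : M.amp ι B = Amp.op ι (M B) := rfl

theorem simpleOp_amp_apply (M : POVM Ω H) (q : SimpleFunc Ω ℝ) (z : Amp ι H) (j : ι) :
    (M.amp ι).simpleOp q z j = M.simpleOp q (z j) := by
  simp only [simpleOp_eq_sum, _root_.sum_apply]
  rw [lp.coeFn_sum, Finset.sum_apply]
  refine Finset.sum_congr rfl fun c _ => ?_
  simp only [← Complex.coe_smul, _root_.smul_apply, lp.coeFn_smul, Pi.smul_apply]
  rfl

theorem IsMixture.amp {S : Type*} [MeasurableSpace S] {κ : S → POVM Ω H} {p : Measure S}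
    [IsProbabilityMeasure p] {M : POVM Ω H} (hM : IsMixture κ p M) :
    IsMixture (fun s => (κ s).amp ι) p (M.amp ι) := by
  have key : ∀ B, MeasurableSet B → ∀ z w : Amp ι H,
      AEStronglyMeasurable (fun s => ⟪z, Amp.op ι (κ s B) w⟫_ℂ) p ∧
        ⟪z, Amp.op ι (M B) w⟫_ℂ = ∫ s, ⟪z, Amp.op ι (κ s B) w⟫_ℂ ∂p := by
    intro B hB z w
    -- The index set may be uncountable, but `z` has countable support; both the measurability of
    -- limits and dominated convergence need this countability.
    let J : Set ι := {j | z j ≠ 0}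
    have : Countable J := (Amp.countable_support z).to_subtype
    have hJ : ∀ N : H →L[ℂ] H,
        HasSum (fun j : J => ⟪z j, N (w j)⟫_ℂ) ⟪z, Amp.op ι N w⟫_ℂ := by
      intro N
      refine (hasSum_subtype_iff_of_support_subset ?_).2 (Amp.hasSum_inner_op N z w)
      intro j hj
      rw [Function.mem_support] at hj
      intro h0
      exact hj (by rw [h0, inner_zero_left])
    have hm : ∀ j : J, AEStronglyMeasurable (fun s => ⟪z j, κ s B (w j)⟫_ℂ) p :=
      fun j => hM.1 B hB _ _
    refine ⟨aestronglyMeasurable_of_tendsto_ae (u := (atTop : Filter (Finset J)))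
      (f := fun F s => ∑ j ∈ F, ⟪z j, κ s B (w j)⟫_ℂ)
      (fun F => Finset.aestronglyMeasurable_fun_sum F fun j _ => hm j)
      (Eventually.of_forall fun s => hJ (κ s B)), ?_⟩
    have hsum : Summable fun j : J => ‖z j‖ * ‖w j‖ :=
      (Amp.tsum_norm_mul_norm_le z w).1.subtype J
    have h1 := hasSum_integral_of_dominated_convergence (μ := p)
      (F := fun (j : J) s => ⟪z j, κ s B (w j)⟫_ℂ) (fun j _ => ‖z j‖ * ‖w j‖) hm
      (fun j => Eventually.of_forall fun s => (κ s).norm_inner_le hB _ _)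
      (Eventually.of_forall fun _ => hsum) (integrable_const _)
      (Eventually.of_forall fun s => hJ (κ s B))
    refine (hJ (M B)).unique ?_
    simp only [hM.2 B hB]
    exact h1
  exact ⟨fun B hB z w => (key B hB z w).1, fun B hB z w => (key B hB z w).2⟩

end POVM

end QuantumEstimation

/-! ### Purification of the state and the embedding of the SLD space -/

namespace QuantumEstimation

open Filter Topology
open scoped NNReal

variable {H : Type u} [NormedAddCommGroup H] [InnerProductSpace ℂ H] [CompleteSpace H]

namespace Amp

variable {ι : Type*} {H : Type*} [NormedAddCommGroup H] [InnerProductSpace ℂ H]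

theorem summable_norm_inner_mul_inner {κ : Type*} (b : HilbertBasis κ ℂ H) (x y : H) :
    (Summable fun k => ‖⟪x, b k⟫_ℂ * ⟪b k, y⟫_ℂ‖) ∧
      ∑' k, ‖⟪x, b k⟫_ℂ * ⟪b k, y⟫_ℂ‖ ≤ ‖x‖ * ‖y‖ := by
  have h := tsum_norm_mul_norm_le (b.repr x) (b.repr y)
  rw [b.repr.norm_map, b.repr.norm_map] at h
  have e : ∀ k, ‖⟪x, b k⟫_ℂ * ⟪b k, y⟫_ℂ‖ = ‖b.repr x k‖ * ‖b.repr y k‖ := fun k => by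
    rw [b.repr_apply_apply, b.repr_apply_apply, norm_mul, norm_inner_symm x]
  simp only [e]
  exact h

/-- Parseval's identity for two square summable families of vectors. -/
theorem hasSum_inner_mul_inner {κ : Type*} (b : HilbertBasis κ ℂ H) (z w : Amp ι H) :
    (∀ k, Summable fun j => ⟪z j, b k⟫_ℂ * ⟪b k, w j⟫_ℂ) ∧
      HasSum (fun k => ∑' j, ⟪z j, b k⟫_ℂ * ⟪b k, w j⟫_ℂ) ⟪z, w⟫_ℂ := by
  have hb := summable_norm_inner_mul_inner b
  have hs : Summable fun a : ι × κ => ⟪z a.1, b a.2⟫_ℂ * ⟪b a.2, w a.1⟫_ℂ := by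
    refine Summable.of_norm ?_
    rw [summable_prod_of_nonneg fun a => norm_nonneg _]
    refine ⟨fun j => (hb (z j) (w j)).1, ?_⟩
    exact Summable.of_nonneg_of_le (fun j => tsum_nonneg fun k => norm_nonneg _)
      (fun j => (hb (z j) (w j)).2) (tsum_norm_mul_norm_le z w).1
  have h1 := hs.hasSum.prod_fiberwise fun j => b.hasSum_inner_mul_inner (z j) (w j)
  have h2 : ∑' a : ι × κ, ⟪z a.1, b a.2⟫_ℂ * ⟪b a.2, w a.1⟫_ℂ = ⟪z, w⟫_ℂ :=
    h1.unique (lp.hasSum_inner z w)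
  refine ⟨fun k => hs.prod_symm.prod_factor k, ?_⟩
  have h3 := hs.prod_symm.hasSum.prod_fiberwise fun k => (hs.prod_symm.prod_factor k).hasSum
  rw [← h2, ← (Equiv.prodComm ι κ).symm.tsum_eq]
  exact h3

end Amp

variable {ρ : DensityOperator H}

theorem sqrt_mul_sqrt_eigenvalue (j : ρ.Index) :
    ((√(ρ.eigenvalue j) : ℝ) : ℂ) * ((√(ρ.eigenvalue j) : ℝ) : ℂ) = ρ.eigenvalue j := by
  rw [← Complex.ofReal_mul, Real.mul_self_sqrt (ρ.eigenvalue_nonneg j)]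

theorem norm_sqrt_eigenvalue_smul_sq (j : ρ.Index) (x : H) :
    ‖((√(ρ.eigenvalue j) : ℝ) : ℂ) • x‖ ^ 2 = ρ.eigenvalue j * ‖x‖ ^ 2 := by
  rw [norm_smul, mul_pow, Complex.norm_real, Real.norm_eq_abs, sq_abs,
    Real.sq_sqrt (ρ.eigenvalue_nonneg j)]

variable (ρ) in
/-- The purification `∑ j, √(s j) φ j ⊗ e j` of the state `ρ`. -/
noncomputable def stateVec : Amp ρ.Index H :=
  ⟨fun j => ((√(ρ.eigenvalue j) : ℝ) : ℂ) • ρ.eigenbasis j, memℓp_gen (by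
    simp only [ENNReal.toReal_ofNat, Real.rpow_ofNat, norm_sqrt_eigenvalue_smul_sq,
      ρ.eigenbasis.orthonormal.norm_eq_one, one_pow, mul_one]
    exact ρ.hasSum_eigenvalue.summable)⟩

theorem stateVec_apply (j : ρ.Index) :
    stateVec ρ j = ((√(ρ.eigenvalue j) : ℝ) : ℂ) • ρ.eigenbasis j := rfl

/-- The family `√(s j) X φ j`. -/
noncomputable def L2sa.vec (X : L2sa ρ) : Amp ρ.Index H :=
  ⟨fun j => ((√(ρ.eigenvalue j) : ℝ) : ℂ) • apply₀ X.1 (ρ.eigenbasis j), memℓp_gen (by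
    simp only [ENNReal.toReal_ofNat, Real.rpow_ofNat, norm_sqrt_eigenvalue_smul_sq]
    exact X.2.summable)⟩

theorem L2sa.vec_apply (X : L2sa ρ) (j : ρ.Index) :
    X.vec j = ((√(ρ.eigenvalue j) : ℝ) : ℂ) • apply₀ X.1 (ρ.eigenbasis j) := rfl

/-- The isometric embedding of `𝓛²_sa(ρ)` into the purifying space. -/
noncomputable def QuotL2sa.vec : QuotL2sa ρ → Amp ρ.Index H :=
  Quotient.lift L2sa.vec fun X Y h => by
    ext j
    rw [L2sa.vec_apply, L2sa.vec_apply]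
    by_cases hj : ρ.eigenvalue j = 0
    · simp [hj]
    · rw [h j hj]

theorem QuotL2sa.vec_mk (X : L2sa ρ) :
    QuotL2sa.vec (Quotient.mk (l2saSetoid ρ) X : QuotL2sa ρ) = X.vec := rfl

theorem sldInner_eq (X Y : QuotL2sa ρ) : sldInner X Y = (⟪X.vec, Y.vec⟫_ℂ).re := by
  induction X using Quotient.inductionOn with | _ X
  induction Y using Quotient.inductionOn with | _ Y
  have h := Complex.hasSum_re (lp.hasSum_inner (𝕜 := ℂ) X.vec Y.vec)
  change ∑' j, _ = (⟪X.vec, Y.vec⟫_ℂ).re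
  rw [← h.tsum_eq]
  refine tsum_congr fun j => ?_
  rw [L2sa.vec_apply, L2sa.vec_apply, inner_smul_left, inner_smul_right, Complex.conj_ofReal,
    ← mul_assoc, sqrt_mul_sqrt_eigenvalue, Complex.re_ofReal_mul]

theorem inner_jordan (X : QuotL2sa ρ) (a b : H) :
    HasSum (fun j => ⟪X.vec j, b⟫_ℂ * ⟪a, stateVec ρ j⟫_ℂ + ⟪stateVec ρ j, b⟫_ℂ * ⟪a, X.vec j⟫_ℂ)
      (2 * ⟪a, jordan X b⟫_ℂ) := by
  induction X using Quotient.inductionOn with | _ X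
  let c : ρ.Index → (H →L[ℂ] H) := fun j => (ρ.eigenvalue j : ℂ) •
      (InnerProductSpace.rankOne ℂ (ρ.eigenbasis j) (apply₀ X.1 (ρ.eigenbasis j)) +
        InnerProductSpace.rankOne ℂ (apply₀ X.1 (ρ.eigenbasis j)) (ρ.eigenbasis j))
  have hs : Summable c := by
    -- With `u = ‖X φ_j‖`, the two rank one terms have norm at most `2u ≤ 1 + u²`, so the series
    -- converges in operator norm.
    refine Summable.of_norm_bounded (g := fun j => ρ.eigenvalue j +
      ρ.eigenvalue j * ‖apply₀ X.1 (ρ.eigenbasis j)‖ ^ 2)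
      (ρ.hasSum_eigenvalue.summable.add X.2.summable) fun j => ?_
    have h0 := ρ.eigenvalue_nonneg j
    rw [norm_smul, Complex.norm_real, Real.norm_eq_abs, abs_of_nonneg h0]
    have h1 := norm_add_le
      (InnerProductSpace.rankOne ℂ (ρ.eigenbasis j) (apply₀ X.1 (ρ.eigenbasis j)))
      (InnerProductSpace.rankOne ℂ (apply₀ X.1 (ρ.eigenbasis j)) (ρ.eigenbasis j))
    rw [InnerProductSpace.norm_rankOne, InnerProductSpace.norm_rankOne,
      ρ.eigenbasis.orthonormal.norm_eq_one] at h1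
    nlinarith [mul_le_mul_of_nonneg_left h1 h0,
      mul_nonneg h0 (sq_nonneg (‖apply₀ X.1 (ρ.eigenbasis j)‖ - 1))]
  have e : 2 * ⟪a, jordan (Quotient.mk (l2saSetoid ρ) X : QuotL2sa ρ) b⟫_ℂ = ⟪a, (∑' j, c j) b⟫_ℂ := by
    change 2 * ⟪a, ((1 / 2 : ℂ) • ∑' j, c j) b⟫_ℂ = _
    rw [_root_.smul_apply, inner_smul_right]
    ring
  change HasSum _ (2 * ⟪a, jordan (Quotient.mk (l2saSetoid ρ) X : QuotL2sa ρ) b⟫_ℂ)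
  rw [e]
  have h := (hs.hasSum.mapL (ContinuousLinearMap.apply ℂ H b)).mapL (innerSL ℂ a)
  convert! h using 2 with j
  change _ = ⟪a, c j b⟫_ℂ
  rw [_root_.smul_apply, _root_.add_apply, InnerProductSpace.rankOne_apply,
    InnerProductSpace.rankOne_apply, inner_smul_right, inner_add_right, inner_smul_right,
    inner_smul_right, stateVec_apply]
  change ⟪X.vec j, b⟫_ℂ * _ + _ * ⟪a, X.vec j⟫_ℂ = _
  rw [L2sa.vec_apply, inner_smul_left, inner_smul_right, inner_smul_left, inner_smul_right,
    Complex.conj_ofReal, ← sqrt_mul_sqrt_eigenvalue]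
  ring

/-- The trace is a sum over the eigenbasis and `ρ ∘ X` is itself a series. Moving `A` to the left as
its adjoint makes each trace term an instance of `inner_jordan`; Parseval for families justifies
interchanging the two sums. -/
theorem trace_mul_jordan (X : QuotL2sa ρ) (A : H →L[ℂ] H) :
    ρ.trace (A * jordan X) =
      (⟪X.vec, Amp.op ρ.Index A (stateVec ρ)⟫_ℂ + ⟪stateVec ρ, Amp.op ρ.Index A X.vec⟫_ℂ) / 2 := by
  have h1 := Amp.hasSum_inner_mul_inner ρ.eigenbasis X.vec (Amp.op ρ.Index A (stateVec ρ))
  have h2 := Amp.hasSum_inner_mul_inner ρ.eigenbasis (stateVec ρ) (Amp.op ρ.Index A X.vec)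
  have h3 := (h1.2.add h2.2).div_const 2
  rw [← h3.tsum_eq]
  refine tsum_congr fun k => ?_
  rw [← (h1.1 k).tsum_add (h2.1 k), eq_div_iff two_ne_zero, mul_comm, mul_apply_eq_comp,
    ← ContinuousLinearMap.adjoint_inner_left, ← (inner_jordan X _ _).tsum_eq]
  refine tsum_congr fun j => ?_
  simp only [ContinuousLinearMap.adjoint_inner_left, Amp.op_apply]

theorem apply₀_of_mem {H : Type*} [NormedAddCommGroup H] [InnerProductSpace ℂ H] {X : H →ₗ.[ℂ] H} {v : H} (h : v ∈ X.domain) : apply₀ X v = X ⟨v, h⟩ :=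
  dif_pos h

theorem inner_apply₀_symm {X : H →ₗ.[ℂ] H} (hX : IsSelfAdjoint X) {v w : H} (hv : v ∈ X.domain)
    (hw : w ∈ X.domain) : ⟪apply₀ X v, w⟫_ℂ = ⟪v, apply₀ X w⟫_ℂ := by
  rw [apply₀_of_mem hv, apply₀_of_mem hw]
  have h := LinearPMap.adjoint_isFormalAdjoint hX.dense_domain
  rw [LinearPMap.isSelfAdjoint_def.1 hX] at h
  exact h ⟨v, hv⟩ ⟨w, hw⟩

/-- The matrix elements of `X` in terms of those of `ρ ∘ X`. -/
theorem inner_vec (X : QuotL2sa ρ) (i k : ρ.Index) :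
    ⟪ρ.eigenbasis i, X.vec k⟫_ℂ =
      (2 * √(ρ.eigenvalue k) / (ρ.eigenvalue i + ρ.eigenvalue k) : ℝ) *
        ⟪ρ.eigenbasis i, jordan X (ρ.eigenbasis k)⟫_ℂ := by
  classical
  have hsum := inner_jordan X (ρ.eigenbasis i) (ρ.eigenbasis k)
  have hon := orthonormal_iff_ite.1 ρ.eigenbasis.orthonormal
  induction X using Quotient.inductionOn with | _ X
  change ⟪ρ.eigenbasis i, X.vec k⟫_ℂ = _
  change HasSum (fun j => ⟪X.vec j, _⟫_ℂ * _ + _ * ⟪_, X.vec j⟫_ℂ) _ at hsum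
  by_cases hk : ρ.eigenvalue k = 0
  · simp [L2sa.vec_apply, hk]
  have hpos : 0 < ρ.eigenvalue i + ρ.eigenvalue k :=
    add_pos_of_nonneg_of_pos (ρ.eigenvalue_nonneg i)
      (lt_of_le_of_ne (ρ.eigenvalue_nonneg k) (Ne.symm hk))
  -- Only `j = i` survives here, and only `j = k` in the other half. Selfadjointness turns `⟨X φ_i,
  -- φ_k⟩` into `⟨φ_i, X φ_k⟩`, so that `2 (ρ ∘ X)_ik = (s_i + s_k) X_ik`.
  have h1 : HasSum (fun j => ⟪X.vec j, ρ.eigenbasis k⟫_ℂ * ⟪ρ.eigenbasis i, stateVec ρ j⟫_ℂ)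
      (ρ.eigenvalue i * ⟪ρ.eigenbasis i, apply₀ X.1 (ρ.eigenbasis k)⟫_ℂ) := by
    convert! hasSum_single (f := fun j => ⟪X.vec j, ρ.eigenbasis k⟫_ℂ *
      ⟪ρ.eigenbasis i, stateVec ρ j⟫_ℂ) i ?_ using 1
    · simp only [stateVec_apply, L2sa.vec_apply, inner_smul_left, inner_smul_right, hon, if_true,
        Complex.conj_ofReal, mul_one]
      rw [mul_right_comm, sqrt_mul_sqrt_eigenvalue]
      by_cases hi : ρ.eigenvalue i = 0
      · simp [hi]
      · rw [inner_apply₀_symm X.2.isSelfAdjoint (X.2.mem_domain _ hi) (X.2.mem_domain _ hk)]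
    · intro j hj
      simp [stateVec_apply, hon, hj.symm]
  have h2 : HasSum (fun j => ⟪stateVec ρ j, ρ.eigenbasis k⟫_ℂ * ⟪ρ.eigenbasis i, X.vec j⟫_ℂ)
      (ρ.eigenvalue k * ⟪ρ.eigenbasis i, apply₀ X.1 (ρ.eigenbasis k)⟫_ℂ) := by
    convert! hasSum_single (f := fun j => ⟪stateVec ρ j, ρ.eigenbasis k⟫_ℂ *
      ⟪ρ.eigenbasis i, X.vec j⟫_ℂ) k ?_ using 1
    · simp only [stateVec_apply, L2sa.vec_apply, inner_smul_left, inner_smul_right, hon, if_true,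
        Complex.conj_ofReal, mul_one]
      rw [← mul_assoc, sqrt_mul_sqrt_eigenvalue]
    · intro j hj
      simp [stateVec_apply, hon, hj]
  have h3 := hsum.unique (h1.add h2)
  rw [L2sa.vec_apply, inner_smul_right]
  have hne : ((ρ.eigenvalue i : ℂ) + ρ.eigenvalue k) ≠ 0 := by exact_mod_cast hpos.ne'
  push_cast
  field_simp
  linear_combination (-(√(ρ.eigenvalue k) : ℂ)) * h3

theorem vec_ext {X : QuotL2sa ρ} {z : Amp ρ.Index H}
    (h : ∀ i k, ⟪ρ.eigenbasis i, X.vec k⟫_ℂ = ⟪ρ.eigenbasis i, z k⟫_ℂ) : X.vec = z := by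
  ext k
  refine ρ.eigenbasis.repr.injective ?_
  ext i
  rw [HilbertBasis.repr_apply_apply, HilbertBasis.repr_apply_apply, h]

/-- A sum of unbounded selfadjoint operators need not be selfadjoint, so linearity is read off from
`ρ ∘ X`, whose matrix elements determine those of the vector. -/
theorem vec_add {X Y Z : QuotL2sa ρ} (h : jordan X = jordan Y + jordan Z) :
    X.vec = Y.vec + Z.vec := by
  refine vec_ext fun i k => ?_
  rw [lp.coeFn_add, Pi.add_apply, inner_add_right, inner_vec, inner_vec, inner_vec, h,
    _root_.add_apply, inner_add_right, mul_add]

theorem vec_smul {X Y : QuotL2sa ρ} (c : ℝ) (h : jordan X = c • jordan Y) :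
    X.vec = (c : ℂ) • Y.vec := by
  refine vec_ext fun i k => ?_
  rw [lp.coeFn_smul, Pi.smul_apply, inner_smul_right, inner_vec, inner_vec, h, ← Complex.coe_smul,
    _root_.smul_apply, inner_smul_right, mul_left_comm]

theorem jordan_injective : Function.Injective (jordan (ρ := ρ)) := by
  intro X Y h
  have hv : X.vec = Y.vec := by simpa using vec_smul 1 (by simpa using h)
  induction X using Quotient.inductionOn with | _ X
  induction Y using Quotient.inductionOn with | _ Y
  refine Quotient.sound fun k hk => ?_
  have h1 : X.vec k = Y.vec k := congrArg (fun z : Amp ρ.Index H => z k) hv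
  rw [L2sa.vec_apply, L2sa.vec_apply] at h1
  refine smul_right_injective H ?_ h1
  have : √(ρ.eigenvalue k) ≠ 0 := (Real.sqrt_ne_zero (ρ.eigenvalue_nonneg k)).2 hk
  exact_mod_cast this

theorem jordan_eq_zero {X : QuotL2sa ρ} (h : X.vec = 0) : jordan X = 0 := by
  ext b
  refine ext_inner_left ℂ fun a => ?_
  have := inner_jordan X a b
  simp only [h, lp.coeFn_zero, Pi.zero_apply, inner_zero_left, inner_zero_right, zero_mul,
    mul_zero, add_zero] at this
  simpa using this.unique hasSum_zero

end QuantumEstimation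

/-! ### Laws and means in the purified picture -/

namespace QuantumEstimation

open Filter Topology
open scoped NNReal

variable {H : Type u} [NormedAddCommGroup H] [InnerProductSpace ℂ H] [CompleteSpace H]
  {ρ : DensityOperator H}

section Law

variable {Ω : Type*} [MeasurableSpace Ω]

theorem POVM.trace_mul_op (M : POVM Ω H) (B : Set Ω) :
    ρ.trace (M B * ρ.op) = ⟪stateVec ρ, M.amp ρ.Index B (stateVec ρ)⟫_ℂ := by
  rw [lp.inner_eq_tsum]
  refine tsum_congr fun j => ?_
  change _ = ⟪_, M B (stateVec ρ j)⟫_ℂ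
  rw [stateVec_apply, mul_apply_eq_comp, ρ.op_eigenbasis, map_smul, map_smul, inner_smul_left,
    inner_smul_right, inner_smul_right, Complex.conj_ofReal, ← mul_assoc, sqrt_mul_sqrt_eigenvalue]

theorem POVM.law_apply (M : POVM Ω H) {B : Set Ω} (hB : MeasurableSet B) :
    M.law ρ B = ENNReal.ofReal (ρ.trace (M B * ρ.op)).re := Measure.ofMeasurable_apply B hB

theorem POVM.law_eq_diag_amp (M : POVM Ω H) :
    M.law ρ = (M.amp ρ.Index).diag (stateVec ρ) := by
  ext B hB
  rw [M.law_apply hB, POVM.diag_apply _ _ hB, M.trace_mul_op]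

theorem POVM.law_map {Ω' : Type*} [MeasurableSpace Ω'] (M : POVM Ω H) {φ : Ω → Ω'}
    (hφ : Measurable φ) : (M.map φ hφ).law ρ = (M.law ρ).map φ := by
  ext B hB
  rw [Measure.map_apply hφ hB, POVM.law_apply _ hB, M.law_apply (hφ hB)]
  rfl

theorem POVM.re_trace_mul_op (M : POVM Ω H) {B : Set Ω} (hB : MeasurableSet B) :
    (ρ.trace (M B * ρ.op)).re = (M.amp ρ.Index).offDiag (stateVec ρ) (stateVec ρ) B := by
  rw [M.trace_mul_op, POVM.offDiag_apply _ _ _ hB]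

theorem POVM.re_trace_mul_jordan (M : POVM Ω H) (X : QuotL2sa ρ) {B : Set Ω}
    (hB : MeasurableSet B) :
    (ρ.trace (M B * jordan X)).re = (M.amp ρ.Index).offDiag (stateVec ρ) X.vec B := by
  have h := (M.amp ρ.Index).re_inner_symm hB (stateVec ρ) X.vec
  rw [POVM.offDiag_apply _ _ _ hB, trace_mul_jordan, Complex.div_ofNat_re, Complex.add_re]
  rw [POVM.amp_apply] at h ⊢
  rw [h]
  ring

/-- The law is the mixture of the diagonal measures of the `φ_j` with weights `s_j`, and each has
second moment `‖X φ_j‖²`. Indices with `s_j = 0` contribute nothing, so `φ_j` may lie outside the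
domain there. -/
theorem POVM.lintegral_law_sq {X : L2sa ρ} {E : POVM ℝ H} (hE : IsSpectralMeasure X.1 E) :
    ∫⁻ t, ENNReal.ofReal (t ^ 2) ∂E.law ρ = ENNReal.ofReal (‖X.vec‖ ^ 2) := by
  have hlaw : E.law ρ = Measure.sum fun j => ENNReal.ofReal (ρ.eigenvalue j) •
      E.diag (ρ.eigenbasis j) := by
    ext B hB
    rw [E.law_apply hB, E.ofReal_trace ρ hB, Measure.sum_apply _ hB]
    rfl
  rw [hlaw, lintegral_sum_measure, Amp.norm_sq_eq_tsum, ENNReal.ofReal_tsum_of_nonneg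
    (fun j => sq_nonneg _) (Amp.summable_norm_sq _)]
  refine tsum_congr fun j => ?_
  rw [lintegral_smul_measure, L2sa.vec_apply, norm_sqrt_eigenvalue_smul_sq,
    ENNReal.ofReal_mul (ρ.eigenvalue_nonneg j), smul_eq_mul]
  by_cases hj : ρ.eigenvalue j = 0
  · simp [hj]
  · have hd := X.2.mem_domain j hj
    rw [apply₀_of_mem hd, ← hE.lintegral_sq X.2.isSelfAdjoint.dense_domain ⟨_, hd⟩]

theorem POVM.norm_simpleOp_amp_apply_le {X : L2sa ρ} {E : POVM ℝ H}
    (hE : IsSpectralMeasure X.1 E) {q : SimpleFunc ℝ ℝ} {C : ℝ} (hC : 0 ≤ C)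
    (hq : ∀ t, |q t| ≤ C * |t|) (j : ρ.Index) :
    ‖(E.amp ρ.Index).simpleOp q (stateVec ρ) j‖ ≤ C * ‖X.vec j‖ := by
  rw [POVM.simpleOp_amp_apply, stateVec_apply, L2sa.vec_apply, map_smul]
  by_cases hj : ρ.eigenvalue j = 0
  · simp [hj]
  · have hd := X.2.mem_domain j hj
    rw [norm_smul, norm_smul, mul_left_comm, apply₀_of_mem hd]
    gcongr
    exact hE.norm_simpleOp_le X.2.isSelfAdjoint.dense_domain hC hq ⟨_, hd⟩

theorem POVM.norm_simpleOp_amp_le {X : L2sa ρ} {E : POVM ℝ H} (hE : IsSpectralMeasure X.1 E)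
    {q : SimpleFunc ℝ ℝ} {C : ℝ} (hC : 0 ≤ C) (hq : ∀ t, |q t| ≤ C * |t|) :
    ‖(E.amp ρ.Index).simpleOp q (stateVec ρ)‖ ≤ C * ‖X.vec‖ :=
  Amp.norm_le_of_forall_norm_le hC fun j => POVM.norm_simpleOp_amp_apply_le hE hC hq j

theorem POVM.tendsto_inner_simpleOp_amp {X : L2sa ρ} {E : POVM ℝ H}
    (hE : IsSpectralMeasure X.1 E) {q : ℕ → SimpleFunc ℝ ℝ} {C r : ℝ} (hC : 0 ≤ C)
    (hq : ∀ n t, |q n t| ≤ C * |t|) (hr : ∀ t, Tendsto (fun n => q n t) atTop (𝓝 (r * t)))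
    (y : Amp ρ.Index H) :
    Tendsto (fun n => ⟪y, (E.amp ρ.Index).simpleOp (q n) (stateVec ρ)⟫_ℂ) atTop
      (𝓝 (r * ⟪y, X.vec⟫_ℂ)) := by
  have hlim : ∀ j, Tendsto (fun n => ⟪y j, (E.amp ρ.Index).simpleOp (q n) (stateVec ρ) j⟫_ℂ) atTop
      (𝓝 (r * ⟪y j, X.vec j⟫_ℂ)) := by
    intro j
    simp only [POVM.simpleOp_amp_apply, stateVec_apply, L2sa.vec_apply, map_smul, inner_smul_right]
    by_cases hj : ρ.eigenvalue j = 0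
    · simp [hj]
    · rw [mul_left_comm, ← inner_smul_right _ (apply₀ X.1 _)]
      refine Tendsto.const_mul _ ?_
      have hd := X.2.mem_domain j hj
      rw [apply₀_of_mem hd]
      exact tendsto_const_nhds.inner
        (hE.tendsto_simpleOp X.2.isSelfAdjoint.dense_domain hq hr ⟨_, hd⟩)
  simp only [lp.inner_eq_tsum]
  rw [← tsum_mul_left]
  refine tendsto_tsum_of_dominated_convergence (bound := fun j => C * (‖y j‖ * ‖X.vec j‖))
    ((Amp.tsum_norm_mul_norm_le y X.vec).1.mul_left C) hlim
    (Eventually.of_forall fun n j => (norm_inner_le_norm _ _).trans ?_)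
  rw [mul_left_comm]
  gcongr
  exact POVM.norm_simpleOp_amp_apply_le hE hC (hq n) j

end Law

/-- A signed measure is determined by its values on measurable sets, so the one in `HasMean` must be
the off-diagonal measure of `Ω` and `y`. -/
theorem hasMean_iff {T : Submodule ℝ (H →L[ℂ] H)} {M : POVM T H} {τ : H →L[ℂ] H}
    {y : Amp ρ.Index H} (hy : ∀ B, MeasurableSet B →
      (ρ.trace (M B * τ)).re = (M.amp ρ.Index).offDiag (stateVec ρ) y B) {v : T} :
    HasMean ρ M τ v ↔ ((M.amp ρ.Index).offDiag (stateVec ρ) y).Integrable (fun x : T => x) ∧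
      ∫ᵛ x, x ∂<•(M.amp ρ.Index).offDiag (stateVec ρ) y = v := by
  constructor
  · rintro ⟨μ, hμ, hi, hv⟩
    have : μ = (M.amp ρ.Index).offDiag (stateVec ρ) y := by
      ext B hB
      rw [hμ B hB, hy B hB]
    subst this
    exact ⟨hi, hv⟩
  · rintro ⟨hi, hv⟩
    exact ⟨_, fun B hB => (hy B hB).symm, hi, hv⟩

theorem signedMeasure_integral_eq_sub {Ω V : Type*} [MeasurableSpace Ω] [NormedAddCommGroup V]
    [NormedSpace ℝ V] [CompleteSpace V] {μ : SignedMeasure Ω} {f : Ω → V} (hf : μ.Integrable f) :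
    Integrable f μ.toJordanDecomposition.posPart ∧ Integrable f μ.toJordanDecomposition.negPart ∧
      ∫ᵛ x, f x ∂<•μ = ∫ x, f x ∂μ.toJordanDecomposition.posPart -
        ∫ x, f x ∂μ.toJordanDecomposition.negPart := by
  have hv : μ.variation = μ.toJordanDecomposition.posPart + μ.toJordanDecomposition.negPart :=
    μ.totalVariation_eq_variation.symm
  have hp : Integrable f μ.toJordanDecomposition.posPart :=
    hf.mono_measure (by rw [hv]; exact Measure.le_add_right le_rfl)
  have hn : Integrable f μ.toJordanDecomposition.negPart :=
    hf.mono_measure (by rw [hv]; exact Measure.le_add_left le_rfl)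
  refine ⟨hp, hn, ?_⟩
  conv_lhs => rw [← μ.toSignedMeasure_toJordanDecomposition]
  rw [JordanDecomposition.toSignedMeasure, VectorMeasure.integral_sub_vectorMeasure,
    VectorMeasure.integral_toSignedMeasure, VectorMeasure.integral_toSignedMeasure]
  · rwa [VectorMeasure.Integrable, Measure.variation_toSignedMeasure]
  · rwa [VectorMeasure.Integrable, Measure.variation_toSignedMeasure]

/-- The Jordan decomposition reduces this to two positive measures. -/
theorem signedMeasure_integral_comp {Ω V W : Type*} [MeasurableSpace Ω] [NormedAddCommGroup V]
    [NormedSpace ℝ V] [CompleteSpace V] [NormedAddCommGroup W] [NormedSpace ℝ W] [CompleteSpace W]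
    (L : V →L[ℝ] W) (μ : SignedMeasure Ω) {f : Ω → V} (hf : μ.Integrable f) :
    L (∫ᵛ x, f x ∂<•μ) = ∫ᵛ x, L (f x) ∂<•μ := by
  obtain ⟨hp, hn, h⟩ := signedMeasure_integral_eq_sub hf
  obtain ⟨-, -, h'⟩ := signedMeasure_integral_eq_sub (f := fun x => L (f x)) (L.integrable_comp hf)
  rw [h, h', map_sub, L.integral_comp_comm hp, L.integral_comp_comm hn]

/-! ### Moments of random measurements -/

section SimpleMeasurement

variable {T : Submodule ℝ (H →L[ℂ] H)} {R : Cotangent ρ T → L2sa ρ}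
  {E : Cotangent ρ T → POVM ℝ H}

/-- Only homogeneity of degree two is used, so the formula covers `g(x,x)`, squares of functionals,
and also the squared operator norm of `T`, which need not be a quadratic form. -/
theorem lintegral_law_simpleMeasurement (hE : ∀ c, IsSpectralMeasure (R c).1 (E c))
    (hR : ∀ c, (Quotient.mk (l2saSetoid ρ) (R c) : QuotL2sa ρ) = c.1)
    (a : T × Cotangent ρ T) {F : T → ℝ} (hF : Measurable F) (hF0 : ∀ x, 0 ≤ F x)
    (hF2 : ∀ (t : ℝ) x, F (t • x) = t ^ 2 * F x) :
    ∫⁻ x, ENNReal.ofReal (F x) ∂(simpleMeasurement E a).law ρ =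
      ENNReal.ofReal (F a.1 * ‖QuotL2sa.vec a.2.1‖ ^ 2) := by
  rw [simpleMeasurement, POVM.law_map, lintegral_map hF.ennreal_ofReal (by fun_prop)]
  simp only [hF2]
  rw [← hR, QuotL2sa.vec_mk, ENNReal.ofReal_mul (hF0 _), ← POVM.lintegral_law_sq (hE _),
    ← lintegral_const_mul' _ _ ENNReal.ofReal_ne_top]
  refine lintegral_congr fun t => ?_
  rw [mul_comm, ENNReal.ofReal_mul (hF0 _)]

variable {p : Measure (T × Cotangent ρ T)} [IsProbabilityMeasure p] {M : POVM T H}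

theorem lintegral_law_mixture (hE : ∀ c, IsSpectralMeasure (R c).1 (E c))
    (hR : ∀ c, (Quotient.mk (l2saSetoid ρ) (R c) : QuotL2sa ρ) = c.1)
    (hM : POVM.IsMixture (simpleMeasurement E) p M) {F : T → ℝ} (hF : Measurable F)
    (hF0 : ∀ x, 0 ≤ F x) (hF2 : ∀ (t : ℝ) x, F (t • x) = t ^ 2 * F x) :
    AEMeasurable (fun a : T × Cotangent ρ T =>
        ENNReal.ofReal (F a.1 * ‖QuotL2sa.vec a.2.1‖ ^ 2)) p ∧
      ∫⁻ x, ENNReal.ofReal (F x) ∂M.law ρ =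
        ∫⁻ a, ENNReal.ofReal (F a.1 * ‖QuotL2sa.vec a.2.1‖ ^ 2) ∂p := by
  have h := (hM.amp (ι := ρ.Index)).lintegral_diag (stateVec ρ) hF.ennreal_ofReal
  simp only [← POVM.law_eq_diag_amp, lintegral_law_simpleMeasurement hE hR _ hF hF0 hF2] at h
  exact h

theorem measurable_linearMap {V : Type*} [NormedAddCommGroup V] [NormedSpace ℝ V]
    [MeasurableSpace V] [BorelSpace V] [FiniteDimensional ℝ V] (f : V →ₗ[ℝ] ℝ) : Measurable f :=
  (LinearMap.continuous_of_finiteDimensional f).measurable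

/-- The first moment formula asks only that the single functional `f` have a finite second moment.
This matters for singular `W`, where a finite deviation controls only the functionals that factor
through `W`. -/
theorem integral_offDiag_mixture [FiniteDimensional ℝ T]
    (hE : ∀ c, IsSpectralMeasure (R c).1 (E c))
    (hR : ∀ c, (Quotient.mk (l2saSetoid ρ) (R c) : QuotL2sa ρ) = c.1)
    (hM : POVM.IsMixture (simpleMeasurement E) p M) (f : T →ₗ[ℝ] ℝ)
    (hf : ∫⁻ x, ENNReal.ofReal (f x ^ 2) ∂M.law ρ < ∞) (y : Amp ρ.Index H) :
    Integrable (fun a : T × Cotangent ρ T => f a.1 * (⟪y, QuotL2sa.vec a.2.1⟫_ℂ).re) p ∧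
      ∫ᵛ x, f x ∂<•(M.amp ρ.Index).offDiag (stateVec ρ) y =
        ∫ a : T × Cotangent ρ T, f a.1 * (⟪y, QuotL2sa.vec a.2.1⟫_ℂ).re ∂p := by
  have hfm := measurable_linearMap f
  obtain ⟨hm, hl⟩ := lintegral_law_mixture hE hR hM (F := fun x => f x ^ 2) (hfm.pow_const 2)
    (fun x => sq_nonneg _) (fun t x => by simp only [map_smul, smul_eq_mul]; ring)
  have hi : ((M.amp ρ.Index).offDiag (stateVec ρ) y).Integrable f := by
    refine POVM.integrable_offDiag _ _ _ hfm.stronglyMeasurable ?_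
    rw [← POVM.law_eq_diag_amp]
    convert! hf using 3 with x
    rw [Real.enorm_eq_ofReal_abs, ← ENNReal.ofReal_pow (abs_nonneg _), sq_abs]
  have hb2 : Integrable (fun a : T × Cotangent ρ T => f a.1 ^ 2 * ‖QuotL2sa.vec a.2.1‖ ^ 2) p := by
    have h1 : ∫⁻ a : T × Cotangent ρ T, ENNReal.ofReal (f a.1 ^ 2 * ‖QuotL2sa.vec a.2.1‖ ^ 2) ∂p
        ≠ ∞ := by rw [← hl]; exact hf.ne
    refine (integrable_toReal_of_lintegral_ne_top hm h1).congr (Eventually.of_forall fun a => ?_)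
    exact ENNReal.toReal_ofReal (by positivity)
  -- The natural bound is `2 |f(x)| ‖X̂‖`; it is replaced by `1 + f(x)² ‖X̂‖²`, which is integrable
  -- by the second moment formula.
  have hb : Integrable (fun a : T × Cotangent ρ T =>
      1 + f a.1 ^ 2 * ‖QuotL2sa.vec a.2.1‖ ^ 2) p := (integrable_const _).add hb2
  have hφ : ∀ x : T, Measurable fun t : ℝ => t • x := fun x => by fun_prop
  have hop : ∀ n (a : T × Cotangent ρ T),
      ((simpleMeasurement E a).amp ρ.Index).simpleOp ((idApprox n).comp f hfm) =
        ((E a.2).amp ρ.Index).simpleOp (((idApprox n).comp f hfm).comp _ (hφ a.1)) :=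
    fun n a => ((E a.2).amp ρ.Index).simpleOp_map (hφ a.1) _
  have hq : ∀ (a : T × Cotangent ρ T) n t,
      |((idApprox n).comp f hfm).comp _ (hφ a.1) t| ≤ 2 * |f a.1| * |t| := fun a n t => by
    refine (abs_idApprox_le n (f (t • a.1))).trans_eq ?_
    rw [map_smul, smul_eq_mul, abs_mul]
    ring
  have hnorm : ∀ n (a : T × Cotangent ρ T),
      ‖((simpleMeasurement E a).amp ρ.Index).simpleOp ((idApprox n).comp f hfm) (stateVec ρ)‖ ≤
        1 + f a.1 ^ 2 * ‖QuotL2sa.vec a.2.1‖ ^ 2 := by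
    intro n a
    rw [hop]
    refine (POVM.norm_simpleOp_amp_le (hE a.2) (C := 2 * |f a.1|) (by positivity)
      fun t => hq a n t).trans ?_
    rw [← QuotL2sa.vec_mk, hR]
    nlinarith [sq_nonneg (|f a.1| * ‖QuotL2sa.vec a.2.1‖ - 1), sq_abs (f a.1)]
  have hlim : ∀ a : T × Cotangent ρ T, Tendsto (fun n =>
      (⟪y, ((simpleMeasurement E a).amp ρ.Index).simpleOp ((idApprox n).comp f hfm)
        (stateVec ρ)⟫_ℂ).re) atTop (𝓝 (f a.1 * (⟪y, QuotL2sa.vec a.2.1⟫_ℂ).re)) := by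
    intro a
    simp only [hop]
    rw [← Complex.re_ofReal_mul, ← hR, QuotL2sa.vec_mk]
    refine (Complex.continuous_re.tendsto _).comp ?_
    refine POVM.tendsto_inner_simpleOp_amp (hE a.2) (C := 2 * |f a.1|) (by positivity) (hq a)
      (fun t => ?_) y
    have := tendsto_idApprox (f (t • a.1))
    rw [map_smul, smul_eq_mul, mul_comm] at this
    refine this.congr fun n => ?_
    simp [mul_comm]
  exact (hM.amp (ι := ρ.Index)).integral_offDiag hfm hi hb hnorm hlim

end SimpleMeasurement

end QuantumEstimation

/-! ### The scalar product of `T` and the lower bound -/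

namespace QuantumEstimation

open Filter Topology
open scoped NNReal

section LinearAlgebra

variable {V : Type*} [AddCommGroup V] [Module ℝ V] {B : LinearMap.BilinForm ℝ V}

/-- An operator that is selfadjoint for a scalar product has an orthonormal eigenbasis. -/
theorem exists_orthonormal_eigenbasis [FiniteDimensional ℝ V] (hsymm : ∀ x y, B x y = B y x)
    (hpos : ∀ x, x ≠ 0 → 0 < B x x) (W : V →ₗ[ℝ] V) (hW : ∀ x y, B (W x) y = B x (W y)) :
    ∃ (e : Module.Basis (Fin (Module.finrank ℝ V)) ℝ V) (w : Fin (Module.finrank ℝ V) → ℝ),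
      (∀ i j, B (e i) (e j) = if i = j then 1 else 0) ∧ ∀ i, W (e i) = w i • e i := by
  -- The inner product structure is local to this proof: the space `T` of the application already
  -- carries the operator norm.
  let core : InnerProductSpace.Core ℝ V :=
    { inner := fun x y => B x y
      conj_inner_symm := fun x y => by simpa using hsymm y x
      re_inner_nonneg := fun x => by
        by_cases hx : x = 0
        · simp [hx]
        · simpa using (hpos x hx).le
      add_left := fun x y z => by simp
      smul_left := fun x y r => by simp
      definite := fun x hx => by
        by_contra h
        exact (hpos x h).ne' hx }
  let _ : NormedAddCommGroup V := core.toNormedAddCommGroup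
  let _ : InnerProductSpace ℝ V := InnerProductSpace.ofCore core.toCore
  have hS : W.IsSymmetric := fun x y => hW x y
  refine ⟨(hS.eigenvectorBasis rfl).toBasis, hS.eigenvalues rfl, fun i j => ?_, fun i => ?_⟩
  · rw [OrthonormalBasis.coe_toBasis]
    exact orthonormal_iff_ite.1 (hS.eigenvectorBasis rfl).orthonormal i j
  · rw [OrthonormalBasis.coe_toBasis]
    exact hS.apply_eigenvectorBasis rfl i

variable {ι : Type*} [Fintype ι] [DecidableEq ι] {e : Module.Basis ι ℝ V}

theorem repr_eq_of_orthonormal (he : ∀ i j, B (e i) (e j) = if i = j then 1 else 0) (x : V)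
    (i : ι) : e.repr x i = B (e i) x := by
  conv_rhs => rw [← e.sum_repr x]
  simp only [map_sum, map_smul, he, smul_eq_mul, mul_ite, mul_one, mul_zero, Finset.sum_ite_eq,
    Finset.mem_univ, if_true]

theorem sum_mul_of_orthonormal (he : ∀ i j, B (e i) (e j) = if i = j then 1 else 0) (x y : V) :
    ∑ i, B (e i) x * B (e i) y = B x y := by
  conv_rhs => rw [← e.sum_repr x]
  simp [repr_eq_of_orthonormal he]

theorem trace_eq_of_orthonormal (he : ∀ i j, B (e i) (e j) = if i = j then 1 else 0)
    (W : V →ₗ[ℝ] V) : LinearMap.trace ℝ V W = ∑ i, B (e i) (W (e i)) := by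
  rw [LinearMap.trace_eq_matrix_trace ℝ e, Matrix.trace]
  refine Finset.sum_congr rfl fun i _ => ?_
  rw [Matrix.diag_apply, LinearMap.toMatrix_apply, repr_eq_of_orthonormal he]

end LinearAlgebra

variable {H : Type u} [NormedAddCommGroup H] [InnerProductSpace ℂ H] [CompleteSpace H]
  {ρ : DensityOperator H} {T : Submodule ℝ (H →L[ℂ] H)}

namespace Cotangent

theorem jordan_Jinv (hT : IsTangentSpace ρ T) (x : T) : jordan (Jinv hT x).1 = x :=
  (hT.exists_jordan_eq x x.2).choose_spec

theorem J_Jinv (hT : IsTangentSpace ρ T) (x : T) : J (Jinv hT x) = x :=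
  Subtype.ext (jordan_Jinv hT x)

theorem J_injective : Function.Injective (J (ρ := ρ) (T := T)) := fun _ _ h =>
  Subtype.ext (jordan_injective (congrArg Subtype.val h))

theorem Jinv_J (hT : IsTangentSpace ρ T) (c : Cotangent ρ T) : Jinv hT (J c) = c :=
  J_injective (J_Jinv hT (J c))

instance : MeasurableSingletonClass (Cotangent ρ T) := by
  refine ⟨fun c => ⟨{J c}, measurableSet_singleton _, ?_⟩⟩
  ext d
  simp [J_injective.eq_iff]

/-- The vector of the purifying space that represents `J⁻¹ x`. -/
noncomputable def tanVec (hT : IsTangentSpace ρ T) (x : T) : Amp ρ.Index H := (Jinv hT x).1.vec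

theorem vec_eq_tanVec (hT : IsTangentSpace ρ T) (c : Cotangent ρ T) :
    QuotL2sa.vec c.1 = tanVec hT (J c) := by rw [tanVec, Jinv_J]

theorem starInner_eq (hT : IsTangentSpace ρ T) (x y : T) :
    starInner hT x y = (⟪tanVec hT x, tanVec hT y⟫_ℂ).re := sldInner_eq _ _

theorem pairing_eq (hT : IsTangentSpace ρ T) (c : Cotangent ρ T) (x : T) :
    pairing hT c x = starInner hT (J c) x := by rw [starInner, Jinv_J]

theorem tanVec_add (hT : IsTangentSpace ρ T) (x y : T) :
    tanVec hT (x + y) = tanVec hT x + tanVec hT y :=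
  vec_add (by simp only [jordan_Jinv]; rfl)

theorem tanVec_smul (hT : IsTangentSpace ρ T) (c : ℝ) (x : T) :
    tanVec hT (c • x) = (c : ℂ) • tanVec hT x :=
  vec_smul c (by simp only [jordan_Jinv]; rfl)

/-- The scalar product of `T` as a bilinear form. -/
noncomputable def starForm (hT : IsTangentSpace ρ T) : LinearMap.BilinForm ℝ T :=
  LinearMap.mk₂ ℝ (starInner hT)
    (fun x y z => by simp only [starInner_eq, tanVec_add, inner_add_left, Complex.add_re])
    (fun c x y => by
      simp only [starInner_eq, tanVec_smul, inner_smul_left, Complex.conj_ofReal,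
        Complex.re_ofReal_mul, smul_eq_mul])
    (fun x y z => by simp only [starInner_eq, tanVec_add, inner_add_right, Complex.add_re])
    (fun c x y => by
      simp only [starInner_eq, tanVec_smul, inner_smul_right, Complex.re_ofReal_mul, smul_eq_mul])

theorem starForm_apply (hT : IsTangentSpace ρ T) (x y : T) :
    starForm hT x y = starInner hT x y := rfl

theorem starForm_self (hT : IsTangentSpace ρ T) (x : T) :
    starForm hT x x = ‖tanVec hT x‖ ^ 2 := by
  rw [starForm_apply, starInner_eq, inner_self_eq_norm_sq_to_K]
  norm_cast

theorem starForm_symm (hT : IsTangentSpace ρ T) (x y : T) : starForm hT x y = starForm hT y x := by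
  rw [starForm_apply, starForm_apply, starInner_eq, starInner_eq, ← inner_conj_symm,
    Complex.conj_re]

theorem starForm_pos (hT : IsTangentSpace ρ T) (x : T) (hx : x ≠ 0) : 0 < starForm hT x x := by
  rw [starForm_self]
  have : tanVec hT x ≠ 0 := fun h => hx (Subtype.ext (by
    rw [← jordan_Jinv hT x, jordan_eq_zero h]
    rfl))
  positivity

/-- Tracelessness of `x`, from `trace_mul_jordan` with `A = 1`. It yields mean zero in the state
`ρ`. -/
theorem re_inner_stateVec_tanVec (hT : IsTangentSpace ρ T) (x : T) :
    (⟪stateVec ρ, tanVec hT x⟫_ℂ).re = 0 := by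
  have h := trace_mul_jordan (Jinv hT x).1 1
  rw [one_mul, jordan_Jinv, hT.trace_eq_zero x x.2, Amp.op_one] at h
  have h2 := congrArg Complex.re h
  rw [Complex.div_ofNat_re, Complex.add_re, one_apply_eq_self, one_apply_eq_self,
    ← inner_conj_symm (QuotL2sa.vec _), Complex.conj_re, Complex.zero_re] at h2
  change 0 = ((⟪stateVec ρ, tanVec hT x⟫_ℂ).re + (⟪stateVec ρ, tanVec hT x⟫_ℂ).re) / 2 at h2
  linarith

end Cotangent

open Cotangent

theorem hasMean_coe_iff (hT : IsTangentSpace ρ T) {M : POVM T H} {τ v : T} :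
    HasMean ρ M τ v ↔
      ((M.amp ρ.Index).offDiag (stateVec ρ) (tanVec hT τ)).Integrable (fun x : T => x) ∧
      ∫ᵛ x, x ∂<•(M.amp ρ.Index).offDiag (stateVec ρ) (tanVec hT τ) = v :=
  hasMean_iff fun B hB => by rw [← jordan_Jinv hT τ]; exact M.re_trace_mul_jordan _ hB

theorem one_le_deviation [FiniteDimensional ℝ T] (hT : IsTangentSpace ρ T)
    {R : Cotangent ρ T → L2sa ρ} (hR : ∀ c, (Quotient.mk (l2saSetoid ρ) (R c) : QuotL2sa ρ) = c.1)
    {E : Cotangent ρ T → POVM ℝ H} (hE : ∀ c, IsSpectralMeasure (R c).1 (E c))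
    {W : T →ₗ[ℝ] T} (hWsa : ∀ x y, starInner hT (W x) y = starInner hT x (W y))
    (hWtr : LinearMap.trace ℝ T W = 1)
    {g : LinearMap.BilinForm ℝ T} (hg : ∀ x y, g x y = starInner hT (W x) (W y))
    {p : Measure (T × Cotangent ρ T)} [IsProbabilityMeasure p] {M : POVM T H}
    (hM : POVM.IsMixture (simpleMeasurement E) p M) (hMu : IsLocallyUnbiased ρ M) :
    1 ≤ deviation ρ g M := by
  obtain ⟨e, -, he, -⟩ := exists_orthonormal_eigenbasis (starForm_symm hT) (starForm_pos hT) W hWsa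
  -- Assuming a deviation below `1` makes it finite, and this supplies all integrability needed
  -- below.
  by_contra! hlt
  have hgB : ∀ x, g x x = starForm hT (W x) (W x) := fun x => hg x x
  have hg0 : ∀ x, 0 ≤ g x x := fun x => by rw [hgB, starForm_self]; positivity
  let f : Fin (Module.finrank ℝ T) → T →ₗ[ℝ] ℝ := fun i => starForm hT (e i) ∘ₗ W
  have hgf : ∀ x, g x x = ∑ i, f i x ^ 2 := fun x => by
    rw [hgB, ← sum_mul_of_orthonormal he]
    exact Finset.sum_congr rfl fun i _ => (sq _).symm
  have hgm : Measurable fun x => g x x := by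
    simp only [hgf]
    exact Finset.measurable_fun_sum _ fun i _ => (measurable_linearMap (f i)).pow_const 2
  obtain ⟨hm, hl⟩ := lintegral_law_mixture hE hR hM hgm hg0
    fun t x => by simp only [map_smul, LinearMap.smul_apply, smul_eq_mul]; ring
  change deviation ρ g M = _ at hl
  have hfin : ∀ i, ∫⁻ x, ENNReal.ofReal (f i x ^ 2) ∂M.law ρ < ∞ := fun i => by
    refine lt_of_le_of_lt (lintegral_mono fun x => ENNReal.ofReal_le_ofReal ?_)
      (hlt.trans ENNReal.one_lt_top)
    rw [hgf]
    exact Finset.single_le_sum (f := fun i => f i x ^ 2) (fun j _ => sq_nonneg _)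
      (Finset.mem_univ i)
  -- The functional `f i = ⟨e_i, W ·⟩` is tested against the direction `e_i`. Unbiasedness makes its
  -- mean `⟨e_i, W e_i⟩`, and summing over `i` produces the trace of `W`.
  have hmean := fun i => integral_offDiag_mixture hE hR hM (f i) (hfin i) (tanVec hT (e i))
  have hfe : ∀ i, f i (e i) = ∫ a : T × Cotangent ρ T,
      f i a.1 * (⟪tanVec hT (e i), QuotL2sa.vec a.2.1⟫_ℂ).re ∂p := fun i => by
    obtain ⟨hi, hv⟩ := (hasMean_coe_iff hT).1 (hMu.2 (e i))
    rw [← (hmean i).2]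
    conv_lhs => rw [← hv]
    exact signedMeasure_integral_comp (f i).toContinuousLinearMap _ hi
  have hsum : ∀ a : T × Cotangent ρ T,
      ∑ i, f i a.1 * (⟪tanVec hT (e i), QuotL2sa.vec a.2.1⟫_ℂ).re =
        starForm hT (W a.1) (J a.2) := fun a => by
    rw [← sum_mul_of_orthonormal he]
    refine Finset.sum_congr rfl fun i _ => ?_
    rw [vec_eq_tanVec hT, starForm_apply _ (e i) (J a.2), starInner_eq]
    rfl
  have hone : ∫ a : T × Cotangent ρ T, starForm hT (W a.1) (J a.2) ∂p = 1 := by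
    simp only [← hsum]
    rw [integral_finsetSum _ fun i _ => (hmean i).1, ← hWtr, trace_eq_of_orthonormal he]
    exact Finset.sum_congr rfl fun i _ => (hfe i).symm
  have hInt : Integrable (fun a : T × Cotangent ρ T => starForm hT (W a.1) (J a.2)) p := by
    simp only [← hsum]
    exact integrable_finsetSum _ fun i _ => (hmean i).1
  have hr0 : ∀ a : T × Cotangent ρ T, 0 ≤ g a.1 a.1 * ‖QuotL2sa.vec a.2.1‖ ^ 2 :=
    fun a => mul_nonneg (hg0 _) (sq_nonneg _)
  have hne : ∫⁻ a : T × Cotangent ρ T, ENNReal.ofReal (g a.1 a.1 * ‖QuotL2sa.vec a.2.1‖ ^ 2) ∂p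
      ≠ ∞ := by rw [← hl]; exact (hlt.trans ENNReal.one_lt_top).ne
  have hr : Integrable (fun a : T × Cotangent ρ T => g a.1 a.1 * ‖QuotL2sa.vec a.2.1‖ ^ 2) p :=
    (integrable_toReal_of_lintegral_ne_top hm hne).congr
      (Eventually.of_forall fun a => ENNReal.toReal_ofReal (hr0 a))
  have hrint : ∫ a : T × Cotangent ρ T, g a.1 a.1 * ‖QuotL2sa.vec a.2.1‖ ^ 2 ∂p < 1 := by
    rw [← ofReal_integral_eq_lintegral_ofReal hr (Eventually.of_forall hr0)] at hl
    rw [hl] at hlt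
    exact ENNReal.ofReal_lt_one.1 hlt
  -- Cauchy–Schwarz followed by `u ≤ (1 + u²) / 2` with `u = ‖W x‖ ‖X̂‖`. The right side integrates
  -- to `(1 + deviation) / 2 < 1`, while the left side is `1`.
  have hle : ∫ a : T × Cotangent ρ T, starForm hT (W a.1) (J a.2) ∂p ≤
      ∫ a : T × Cotangent ρ T, (1 + g a.1 a.1 * ‖QuotL2sa.vec a.2.1‖ ^ 2) / 2 ∂p := by
    refine integral_mono hInt (((integrable_const _).add hr).div_const 2) fun a => ?_
    have h1 : starForm hT (W a.1) (J a.2) ≤ ‖tanVec hT (W a.1)‖ * ‖QuotL2sa.vec a.2.1‖ := by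
      rw [starForm_apply, starInner_eq, ← vec_eq_tanVec]
      exact (Complex.re_le_norm _).trans (norm_inner_le_norm _ _)
    change _ ≤ (1 + g a.1 a.1 * ‖QuotL2sa.vec a.2.1‖ ^ 2) / 2
    rw [hgB, starForm_self]
    nlinarith [sq_nonneg (‖tanVec hT (W a.1)‖ * ‖QuotL2sa.vec a.2.1‖ - 1)]
  rw [hone, integral_div, integral_add (integrable_const _) hr] at hle
  simp only [integral_const, probReal_univ, smul_eq_mul, mul_one] at hle
  linarith

end QuantumEstimation

/-! ### Finitely supported mixtures and the measurements built from a basis -/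

namespace QuantumEstimation

open Filter Topology
open scoped NNReal

section FiniteSupport

variable {S ι : Type*} [MeasurableSpace S] [Fintype ι] {a : ι → ℝ} {s : ι → S}

theorem isProbabilityMeasure_sum_dirac (ha : ∀ i, 0 ≤ a i) (hsum : ∑ i, a i = 1) :
    IsProbabilityMeasure (∑ i, ENNReal.ofReal (a i) • Measure.dirac (s i)) := by
  refine ⟨?_⟩
  rw [Measure.finsetSum_apply]
  simp only [Measure.smul_apply, measure_univ, smul_eq_mul, mul_one]
  rw [← ENNReal.ofReal_sum_of_nonneg fun i _ => ha i, hsum, ENNReal.ofReal_one]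

variable [MeasurableSingletonClass S]

theorem lintegral_sum_dirac (F : S → ℝ≥0∞) :
    ∫⁻ x, F x ∂(∑ i, ENNReal.ofReal (a i) • Measure.dirac (s i)) =
      ∑ i, ENNReal.ofReal (a i) * F (s i) := by
  rw [lintegral_finsetSum_measure]
  simp only [lintegral_smul_measure, lintegral_dirac, smul_eq_mul]

variable {G : Type*} [NormedAddCommGroup G]

theorem integrable_sum_dirac (F : S → G) :
    Integrable F (∑ i, ENNReal.ofReal (a i) • Measure.dirac (s i)) :=
  integrable_finsetSum_measure.2 fun _ _ =>
    (integrable_dirac enorm_lt_top).smul_measure ENNReal.ofReal_ne_top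

theorem integral_sum_dirac [NormedSpace ℝ G] [CompleteSpace G] (ha : ∀ i, 0 ≤ a i) (F : S → G) :
    ∫ x, F x ∂(∑ i, ENNReal.ofReal (a i) • Measure.dirac (s i)) = ∑ i, a i • F (s i) := by
  rw [integral_finsetSum_measure fun _ _ =>
    (integrable_dirac enorm_lt_top).smul_measure ENNReal.ofReal_ne_top]
  refine Finset.sum_congr rfl fun i _ => ?_
  rw [integral_smul_measure, integral_dirac, ENNReal.toReal_ofReal (ha i)]

end FiniteSupport

variable {H : Type u} [NormedAddCommGroup H] [InnerProductSpace ℂ H] [CompleteSpace H]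
  {ρ : DensityOperator H} {T : Submodule ℝ (H →L[ℂ] H)}

open Cotangent

section

variable {Ω S ι : Type*} [MeasurableSpace Ω] [MeasurableSpace S] [MeasurableSingletonClass S]
  [Fintype ι] {a : ι → ℝ} {s : ι → S}

/-- Since singletons are measurable, every function is a.e. measurable for a finite sum of point
masses, so no regularity of `κ` is needed. -/
theorem POVM.isMixable_sum_dirac (κ : S → POVM Ω H) :
    POVM.IsMixable κ (∑ i, ENNReal.ofReal (a i) • Measure.dirac (s i)) := fun _ _ _ _ =>
  (integrable_sum_dirac _).aestronglyMeasurable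

theorem POVM.IsMixture.apply_of_sum_dirac {κ : S → POVM Ω H} {M : POVM Ω H} (ha : ∀ i, 0 ≤ a i)
    (hM : POVM.IsMixture κ (∑ i, ENNReal.ofReal (a i) • Measure.dirac (s i)) M) {B : Set Ω}
    (hB : MeasurableSet B) : M B = ∑ i, (a i : ℂ) • κ (s i) B := by
  ext χ
  refine ext_inner_left ℂ fun ψ => ?_
  rw [hM.2 B hB, integral_sum_dirac ha, _root_.sum_apply, inner_sum]
  refine Finset.sum_congr rfl fun i _ => ?_
  rw [_root_.smul_apply, inner_smul_right, Complex.real_smul]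

end

/-- The distribution on `T × T*` that gives weight `a i` to the pair `(x, X)` with
`x = (a i)⁻¹ e i`, `X = J⁻¹ (e i)`. -/
noncomputable def basisDistribution {ι : Type*} [Fintype ι] (hT : IsTangentSpace ρ T) (a : ι → ℝ)
    (e : Module.Basis ι ℝ T) : Measure (T × Cotangent ρ T) :=
  ∑ i, ENNReal.ofReal (a i) • Measure.dirac ((a i)⁻¹ • e i, Jinv hT (e i))

section BasisMeasurement

variable {ι : Type*} [Fintype ι] [DecidableEq ι] (hT : IsTangentSpace ρ T)
  {R : Cotangent ρ T → L2sa ρ} {E : Cotangent ρ T → POVM ℝ H}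
  (hR : ∀ c, (Quotient.mk (l2saSetoid ρ) (R c) : QuotL2sa ρ) = c.1)
  (hE : ∀ c, IsSpectralMeasure (R c).1 (E c))
  {a : ι → ℝ} (ha : ∀ i, 0 < a i) {e : Module.Basis ι ℝ T}
  (he : ∀ i j, starForm hT (e i) (e j) = if i = j then 1 else 0)
  {M : POVM T H}

include hT hR hE ha he

/-- The weight `a_i` meets the factor `a_i⁻²` from the dilated vector, and `J⁻¹ e_i` is a unit
vector; what remains is `a_i⁻¹`. -/
theorem lintegral_law_basisMeasurement [IsProbabilityMeasure (basisDistribution hT a e)]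
    (hM : POVM.IsMixture (simpleMeasurement E) (basisDistribution hT a e) M)
    {F : T → ℝ} (hF : Measurable F)
    (hF0 : ∀ x, 0 ≤ F x) (hF2 : ∀ (t : ℝ) x, F (t • x) = t ^ 2 * F x) :
    ∫⁻ x, ENNReal.ofReal (F x) ∂M.law ρ = ENNReal.ofReal (∑ i, (a i)⁻¹ * F (e i)) := by
  rw [(lintegral_law_mixture hE hR hM hF hF0 hF2).2, basisDistribution, lintegral_sum_dirac,
    ENNReal.ofReal_sum_of_nonneg fun i _ => mul_nonneg (inv_nonneg.2 (ha i).le) (hF0 _)]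
  refine Finset.sum_congr rfl fun i _ => ?_
  have h1 : ‖QuotL2sa.vec (Jinv hT (e i)).1‖ ^ 2 = 1 := by
    rw [← tanVec, ← starForm_self, he, if_pos rfl]
  have := (ha i).ne'
  rw [h1, hF2, ← ENNReal.ofReal_mul (ha i).le]
  congr 1
  field_simp

theorem lintegral_enorm_sq_basisMeasurement [IsProbabilityMeasure (basisDistribution hT a e)]
    (hM : POVM.IsMixture (simpleMeasurement E) (basisDistribution hT a e) M) :
    ∫⁻ x, ‖x‖ₑ ^ 2 ∂M.law ρ < ∞ := by
  have h := lintegral_law_basisMeasurement hT hR hE ha he hM (F := fun x => ‖x‖ ^ 2)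
    (by fun_prop) (fun x => sq_nonneg _) fun t x => by
      rw [norm_smul, mul_pow, Real.norm_eq_abs, sq_abs]
  have h2 : ∀ x : T, ‖x‖ₑ ^ 2 = ENNReal.ofReal (‖x‖ ^ 2) := fun x => by
    rw [ENNReal.ofReal_pow (norm_nonneg _), ofReal_norm]
  simp only [h2, h]
  exact ENNReal.ofReal_lt_top

variable [FiniteDimensional ℝ T]

theorem integral_law_mul_basisMeasurement [IsProbabilityMeasure (basisDistribution hT a e)]
    (hM : POVM.IsMixture (simpleMeasurement E) (basisDistribution hT a e) M) (f h : T →ₗ[ℝ] ℝ) :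
    Integrable (fun x => f x * h x) (M.law ρ) ∧
      ∫ x, f x * h x ∂M.law ρ = ∑ i, (a i)⁻¹ * (f (e i) * h (e i)) := by
  have key : ∀ q : T →ₗ[ℝ] ℝ, Integrable (fun x => q x ^ 2) (M.law ρ) ∧
      ∫ x, q x ^ 2 ∂M.law ρ = ∑ i, (a i)⁻¹ * q (e i) ^ 2 := fun q => by
    have hq : Measurable fun x => q x ^ 2 := (measurable_linearMap q).pow_const 2
    have hl := lintegral_law_basisMeasurement hT hR hE ha he hM hq
      (fun x => sq_nonneg _) (fun t x => by simp only [map_smul, smul_eq_mul]; ring)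
    constructor
    · refine (integrable_toReal_of_lintegral_ne_top hq.ennreal_ofReal.aemeasurable
        (by rw [hl]; exact ENNReal.ofReal_ne_top)).congr (Eventually.of_forall fun x => ?_)
      exact ENNReal.toReal_ofReal (sq_nonneg _)
    · rw [integral_eq_lintegral_of_nonneg_ae (Eventually.of_forall fun x => sq_nonneg _)
        hq.aestronglyMeasurable, hl, ENNReal.toReal_ofReal]
      exact Finset.sum_nonneg fun i _ => mul_nonneg (inv_nonneg.2 (ha i).le) (sq_nonneg _)
  -- Polarization reduces mixed second moments to squares, to which the nonnegative formula applies.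
  have hpol : ∀ x, f x * h x = ((f + h) x ^ 2 - (f - h) x ^ 2) / 4 := fun x => by
    rw [LinearMap.add_apply, LinearMap.sub_apply]
    ring
  simp only [hpol]
  refine ⟨((key _).1.sub (key _).1).div_const 4, ?_⟩
  rw [integral_div, integral_sub (key _).1 (key _).1, (key _).2, (key _).2,
    ← Finset.sum_sub_distrib, Finset.sum_div]
  exact Finset.sum_congr rfl fun i _ => by ring

/-- In first moments the weights cancel, `a_i a_i⁻¹ = 1`, so the `i`-th coordinate of the mean is
`Re ⟨y, J⁻¹ e_i⟩`. Both unbiasedness conditions are instances: `y = Ω` with `v = 0`, and the vector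
of `τ` with `v = τ`. -/
theorem integral_offDiag_basisMeasurement [IsProbabilityMeasure (basisDistribution hT a e)]
    (hM : POVM.IsMixture (simpleMeasurement E) (basisDistribution hT a e) M)
    {y : Amp ρ.Index H} {v : T}
    (hy : ∀ i, (⟪y, tanVec hT (e i)⟫_ℂ).re = starForm hT (e i) v) :
    ((M.amp ρ.Index).offDiag (stateVec ρ) y).Integrable (fun x : T => x) ∧
      ∫ᵛ x, x ∂<•(M.amp ρ.Index).offDiag (stateVec ρ) y = v := by
  have hi : ((M.amp ρ.Index).offDiag (stateVec ρ) y).Integrable (fun x : T => x) := by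
    refine POVM.integrable_offDiag _ _ _ stronglyMeasurable_id ?_
    rw [← POVM.law_eq_diag_amp]
    exact lintegral_enorm_sq_basisMeasurement hT hR hE ha he hM
  refine ⟨hi, e.ext_elem fun i => ?_⟩
  have hfin : ∫⁻ x, ENNReal.ofReal (e.coord i x ^ 2) ∂M.law ρ < ∞ := by
    rw [lintegral_law_basisMeasurement hT hR hE ha he hM
      ((measurable_linearMap (e.coord i)).pow_const 2) (fun x => sq_nonneg _)
      (fun t x => by simp only [map_smul, smul_eq_mul]; ring)]
    exact ENNReal.ofReal_lt_top
  have h1 := signedMeasure_integral_comp (e.coord i).toContinuousLinearMap _ hi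
  refine h1.trans ((integral_offDiag_mixture hE hR hM (e.coord i) hfin y).2.trans ?_)
  rw [basisDistribution, integral_sum_dirac fun i => (ha i).le, Finset.sum_eq_single i]
  · have := (ha i).ne'
    simp only [map_smul, Module.Basis.coord_apply, Module.Basis.repr_self, Finsupp.single_eq_same,
      smul_eq_mul, mul_one]
    rw [mul_inv_cancel_left₀ this, ← tanVec, hy, repr_eq_of_orthonormal he]
  · intro k _ hk
    simp [Finsupp.single_eq_of_ne hk.symm]
  · simp

theorem isLocallyUnbiased_basisMeasurement [IsProbabilityMeasure (basisDistribution hT a e)]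
    (hM : POVM.IsMixture (simpleMeasurement E) (basisDistribution hT a e) M) :
    IsLocallyUnbiased ρ M := by
  constructor
  · refine (hasMean_iff fun B hB => M.re_trace_mul_op hB).2
      (integral_offDiag_basisMeasurement hT hR hE ha he hM fun i => ?_)
    rw [re_inner_stateVec_tanVec, map_zero]
  · intro τ
    refine (hasMean_coe_iff hT).2
      (integral_offDiag_basisMeasurement hT hR hE ha he hM fun i => ?_)
    rw [starForm_symm, starForm_apply, starInner_eq]

/-- The weights `a` are kept apart from the eigenvalues `w`, because a semidefinite `W` may have
zero eigenvalues while the weights must be positive. -/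
theorem deviation_basisMeasurement [IsProbabilityMeasure (basisDistribution hT a e)]
    (hM : POVM.IsMixture (simpleMeasurement E) (basisDistribution hT a e) M)
    {W : T →ₗ[ℝ] T} {w : ι → ℝ} (hw : ∀ i, W (e i) = w i • e i)
    {g : LinearMap.BilinForm ℝ T} (hg : ∀ x y, g x y = starInner hT (W x) (W y)) :
    deviation ρ g M = ENNReal.ofReal (∑ i, (a i)⁻¹ * w i ^ 2) := by
  have hgB : ∀ x, g x x = starForm hT (W x) (W x) := fun x => hg x x
  have hgm : Measurable fun x => g x x := by
    have hgs : (fun x => g x x) =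
        fun x => ∑ i, starForm hT (e i) (W x) * starForm hT (e i) (W x) :=
      funext fun x => by rw [sum_mul_of_orthonormal he, hgB]
    rw [hgs]
    exact Finset.measurable_fun_sum _ fun i _ =>
      (measurable_linearMap (starForm hT (e i) ∘ₗ W)).mul
        (measurable_linearMap (starForm hT (e i) ∘ₗ W))
  rw [deviation, lintegral_law_basisMeasurement hT hR hE ha he hM hgm
    (fun x => by rw [hgB, starForm_self]; positivity)
    fun t x => by simp only [map_smul, LinearMap.smul_apply, smul_eq_mul]; ring]
  congr 1
  refine Finset.sum_congr rfl fun i _ => ?_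
  rw [hgB, hw]
  simp only [map_smul, LinearMap.smul_apply, he, if_true, smul_eq_mul]
  ring

/-- The covariance is diagonal in the basis with entries `a_i⁻¹`. When the weights are the
eigenvalues, applying `W` cancels them and leaves the basis expansion of `J c`. -/
theorem covariance_basisMeasurement [IsProbabilityMeasure (basisDistribution hT a e)]
    (hM : POVM.IsMixture (simpleMeasurement E) (basisDistribution hT a e) M)
    {W : T →ₗ[ℝ] T} (hw : ∀ i, W (e i) = a i • e i) (c : Cotangent ρ T) :
    W (covariance hT M c) = J c := by
  have hpair : ∀ x, pairing hT c x = starForm hT (J c) x := fun x => pairing_eq hT c x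
  have hcov : covariance hT M c = ∑ i, ((a i)⁻¹ * starForm hT (J c) (e i)) • e i := by
    have hex : ∀ x : T, pairing hT c x • x =
        ∑ i, (starForm hT (J c) x * e.coord i x) • e i := fun x => by
      conv_lhs => rw [← e.sum_repr x, Finset.smul_sum]
      simp only [smul_smul, e.sum_repr, hpair, Module.Basis.coord_apply]
    have hi := fun i => integral_law_mul_basisMeasurement hT hR hE ha he hM (starForm hT (J c))
      (e.coord i)
    simp only [covariance, hex]
    rw [integral_finsetSum _ fun i _ => (hi i).1.smul_const (e i)]
    refine Finset.sum_congr rfl fun i _ => ?_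
    rw [integral_smul_const, (hi i).2, Finset.sum_eq_single i]
    · simp
    · intro k _ hk
      simp [Finsupp.single_eq_of_ne hk.symm]
    · simp
  rw [hcov, map_sum]
  conv_rhs => rw [← e.sum_repr (J c)]
  refine Finset.sum_congr rfl fun i _ => ?_
  rw [map_smul, hw, smul_smul, repr_eq_of_orthonormal he, starForm_symm, mul_right_comm,
    inv_mul_cancel₀ (ha i).ne', one_mul]

end BasisMeasurement

end QuantumEstimation

/-! ### The theorem: infimum, minimum, and the optimal measurement -/

theorem mainTheorem3 {H : Type u} [NormedAddCommGroup H] [InnerProductSpace ℂ H] [CompleteSpace H]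
    (ρ : DensityOperator H) (T : Submodule ℝ (H →L[ℂ] H)) [FiniteDimensional ℝ T]
    (hT : IsTangentSpace ρ T)
    (R : Cotangent ρ T → L2sa ρ) (hR : ∀ c, (Quotient.mk (l2saSetoid ρ) (R c) : QuotL2sa ρ) = c.1)
    (E : Cotangent ρ T → POVM ℝ H) (hE : ∀ c, IsSpectralMeasure (R c).1 (E c))
    (W : T →ₗ[ℝ] T) (hWsa : ∀ x y, starInner hT (W x) y = starInner hT x (W y))
    (hWpos : ∀ x, 0 ≤ starInner hT (W x) x) (hWtr : LinearMap.trace ℝ T W = 1)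
    (g : LinearMap.BilinForm ℝ T) (hg : ∀ x y, g x y = starInner hT (W x) (W y)) :
    IsGLB (randomDeviations E g) 1 ∧
    ((∀ x, x ≠ 0 → 0 < starInner hT (W x) x) →
      IsLeast (randomDeviations E g) 1 ∧
      (∃ (e : Module.Basis (Fin (Module.finrank ℝ T)) ℝ T) (w : Fin (Module.finrank ℝ T) → ℝ),
        (∀ i j, starInner hT (e i) (e j) = if i = j then 1 else 0) ∧
        ∀ i, W (e i) = w i • e i) ∧
      ∀ (e : Module.Basis (Fin (Module.finrank ℝ T)) ℝ T) (w : Fin (Module.finrank ℝ T) → ℝ),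
        (∀ i j, starInner hT (e i) (e j) = if i = j then 1 else 0) →
        (∀ i, W (e i) = w i • e i) →
        (∀ i, 0 < w i) ∧
        ∃ p : ProbabilityMeasure (T × Cotangent ρ T),
          (p : Measure (T × Cotangent ρ T)) =
            ∑ i, ENNReal.ofReal (w i) • Measure.dirac ((w i)⁻¹ • e i, Jinv hT (e i)) ∧
          ∃ h : POVM.IsMixable (simpleMeasurement E) (p : Measure (T × Cotangent ρ T)),
            (∀ B, MeasurableSet B → POVM.mix (simpleMeasurement E) p h B =
              ∑ i, (w i : ℂ) • simpleMeasurement E ((w i)⁻¹ • e i, Jinv hT (e i)) B) ∧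
            IsLocallyUnbiased ρ (POVM.mix (simpleMeasurement E) p h) ∧
            deviation ρ g (POVM.mix (simpleMeasurement E) p h) = 1 ∧
            MemLp (fun x => x) 2 ((POVM.mix (simpleMeasurement E) p h).law ρ) ∧
            ∀ c, covariance hT (POVM.mix (simpleMeasurement E) p h) c = Ring.inverse W (J c)) := by
  classical
  have hprob : ∀ (e : Module.Basis (Fin (Module.finrank ℝ T)) ℝ T)
      (a : Fin (Module.finrank ℝ T) → ℝ), (∀ i, 0 < a i) → ∑ i, a i = 1 →
      IsProbabilityMeasure (basisDistribution hT a e) := fun e a ha hsum =>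
    isProbabilityMeasure_sum_dirac (fun i => (ha i).le) hsum
  have hmem : ∀ (e : Module.Basis (Fin (Module.finrank ℝ T)) ℝ T)
      (a w : Fin (Module.finrank ℝ T) → ℝ), (∀ i, 0 < a i) → ∑ i, a i = 1 →
      (∀ i j, starForm hT (e i) (e j) = if i = j then 1 else 0) → (∀ i, W (e i) = w i • e i) →
      ENNReal.ofReal (∑ i, (a i)⁻¹ * w i ^ 2) ∈ randomDeviations E g := by
    intro e a w ha hsum he hw
    have := hprob e a ha hsum
    have hM := POVM.isMixture_mix (simpleMeasurement E) (basisDistribution hT a e)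
      (POVM.isMixable_sum_dirac _)
    exact ⟨⟨basisDistribution hT a e, this⟩, hM.1,
      isLocallyUnbiased_basisMeasurement hT hR hE ha he hM,
      deviation_basisMeasurement hT hR hE ha he hM hw hg⟩
  have hlower : 1 ∈ lowerBounds (randomDeviations E g) := by
    rintro _ ⟨p, h, hu, rfl⟩
    exact one_le_deviation hT hR hE hWsa hWtr hg (POVM.isMixture_mix _ _ h) hu
  have heig : ∀ (e : Module.Basis (Fin (Module.finrank ℝ T)) ℝ T)
      (w : Fin (Module.finrank ℝ T) → ℝ),
      (∀ i j, starForm hT (e i) (e j) = if i = j then 1 else 0) → (∀ i, W (e i) = w i • e i) →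
      (∀ i, starInner hT (W (e i)) (e i) = w i) ∧ ∑ i, w i = 1 := by
    intro e w he hw
    refine ⟨fun i => ?_, ?_⟩
    · rw [← starForm_apply, hw, map_smul, LinearMap.smul_apply, he, if_pos rfl, smul_eq_mul, mul_one]
    · rw [← hWtr, trace_eq_of_orthonormal he]
      refine Finset.sum_congr rfl fun i _ => ?_
      rw [hw, map_smul, he, if_pos rfl, smul_eq_mul, mul_one]
  have hexists := exists_orthonormal_eigenbasis (starForm_symm hT) (starForm_pos hT) W hWsa
  obtain ⟨e, w, he, hw⟩ := hexists
  obtain ⟨hwi, hwsum⟩ := heig e w he hw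
  have hw0 : ∀ i, 0 ≤ w i := fun i => hwi i ▸ hWpos (e i)
  -- Trace `1` excludes `T = 0`, so the uniform weights `1/n` exist.
  have hn : 0 < Module.finrank ℝ T := by
    by_contra! h0
    have : IsEmpty (Fin (Module.finrank ℝ T)) := by rw [Nat.le_zero.1 h0]; infer_instance
    simp at hwsum
  have hn' : (0 : ℝ) < Module.finrank ℝ T := Nat.cast_pos.2 hn
  refine ⟨⟨hlower, fun b hb => ?_⟩, fun hpd => ⟨⟨?_, hlower⟩, ⟨e, w, he, hw⟩, fun e w he hw => ?_⟩⟩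
  · have hbε : ∀ ε : ℝ, 0 < ε → ε < 1 → b ≤ ENNReal.ofReal (1 - ε)⁻¹ := by
      intro ε h0 h1
      have h1' : 0 < 1 - ε := sub_pos.2 h1
      have ha : ∀ i, 0 < (1 - ε) * w i + ε / Module.finrank ℝ T := fun i =>
        add_pos_of_nonneg_of_pos (mul_nonneg h1'.le (hw0 i)) (div_pos h0 hn')
      refine (hb (hmem e _ w ha ?_ he hw)).trans (ENNReal.ofReal_le_ofReal ?_)
      · rw [Finset.sum_add_distrib, ← Finset.mul_sum, hwsum, Finset.sum_const, Finset.card_univ,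
          Fintype.card_fin, nsmul_eq_mul, mul_div_cancel₀ _ hn'.ne']
        ring
      · calc ∑ i, ((1 - ε) * w i + ε / Module.finrank ℝ T)⁻¹ * w i ^ 2
            ≤ ∑ i, (1 - ε)⁻¹ * w i := Finset.sum_le_sum fun i _ => by
              rw [inv_mul_le_iff₀ (ha i)]
              have : 0 ≤ ε / Module.finrank ℝ T * ((1 - ε)⁻¹ * w i) :=
                mul_nonneg (div_pos h0 hn').le (mul_nonneg (inv_pos.2 h1').le (hw0 i))
              have h2 : (1 - ε) * w i * ((1 - ε)⁻¹ * w i) = w i ^ 2 := by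
                field_simp
              rw [add_mul, h2]
              linarith
          _ = (1 - ε)⁻¹ := by rw [← Finset.mul_sum, hwsum, mul_one]
    have hlim : Filter.Tendsto (fun ε : ℝ => ENNReal.ofReal (1 - ε)⁻¹) (nhdsWithin 0 (Set.Ioi 0))
        (nhds 1) := by
      have : ContinuousAt (fun ε : ℝ => (1 - ε)⁻¹) 0 :=
        (continuousAt_const.sub continuousAt_id).inv₀ (by simp)
      have h2 := ENNReal.tendsto_ofReal (this.tendsto.mono_left
        (nhdsWithin_le_nhds (s := Set.Ioi 0)))
      simpa using h2
    refine ge_of_tendsto hlim ?_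
    filter_upwards [Ioo_mem_nhdsGT (zero_lt_one' ℝ)] with ε hε using hbε ε hε.1 hε.2
  · have hw1 : ∀ i, 0 < w i := fun i => hwi i ▸ hpd (e i) (e.ne_zero i)
    have h := hmem e w w hw1 hwsum he hw
    have hs : ∑ i, (w i)⁻¹ * w i ^ 2 = 1 := by
      rw [← hwsum]
      exact Finset.sum_congr rfl fun i _ => by rw [sq, inv_mul_cancel_left₀ (hw1 i).ne']
    rwa [hs, ENNReal.ofReal_one] at h
  · obtain ⟨hwi, hwsum⟩ := heig e w he hw
    have hw1 : ∀ i, 0 < w i := fun i => hwi i ▸ hpd (e i) (e.ne_zero i)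
    have := hprob e w hw1 hwsum
    have hM := POVM.isMixture_mix (simpleMeasurement E) (basisDistribution hT w e)
      (POVM.isMixable_sum_dirac _)
    refine ⟨hw1, ⟨basisDistribution hT w e, this⟩, rfl, hM.1,
      fun B hB => hM.apply_of_sum_dirac (fun i => (hw1 i).le) hB,
      isLocallyUnbiased_basisMeasurement hT hR hE hw1 he hM,
      (deviation_basisMeasurement hT hR hE hw1 he hM hw hg).trans ?_, ?_, fun c => ?_⟩
    · rw [← ENNReal.ofReal_one, ← hwsum]
      congr 1
      exact Finset.sum_congr rfl fun i _ => by rw [sq, inv_mul_cancel_left₀ (hw1 i).ne']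
    · refine ⟨aestronglyMeasurable_id, ?_⟩
      rw [eLpNorm_lt_top_iff_lintegral_rpow_enorm_lt_top two_ne_zero ENNReal.ofNat_ne_top]
      simpa using lintegral_enorm_sq_basisMeasurement hT hR hE hw1 he hM
    -- `Ring.inverse W` is the true inverse only for a unit. Definiteness makes `W` injective, hence
    -- invertible in finite dimension, and the identity can be checked after applying `W`.
    · have hinj : Function.Injective W := by
        rw [← LinearMap.ker_eq_bot, LinearMap.ker_eq_bot']
        intro x hx
        by_contra h
        have := hpd x h
        rw [hx, ← starForm_apply, map_zero, LinearMap.zero_apply] at this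
        exact this.false
      have hunit : IsUnit W := (LinearMap.isUnit_iff_ker_eq_bot W).2 (LinearMap.ker_eq_bot.2 hinj)
      refine hinj ?_
      rw [← Module.End.mul_apply, Ring.mul_inverse_cancel W hunit, Module.End.one_apply]
      exact covariance_basisMeasurement hT hR hE hw1 he hM hw c
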